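/- All graphs are finite and simple, and the girth of a graph is the length of a shortest cycle ($\infty$ if there are no cycles). Let $G$ be a graph and $f \colon V(G) \to \mathbb{N} = \{0,1,2,\dots\}$. For $u \in V(G)$, the operation $\mathrm{Delete}(G,f,u)$ outputs the graph $G-u$ and the function $f' \colon V(G-u) \to \mathbb{Z}$ with $f'(v) = f(v)-1$ if $uv \in E(G)$ and $f'(v) = f(v)$ otherwise; it is legal if $f' \ge 0$. For adjacent $u, w \in V(G)$, the operation $\mathrm{DelSave}(G,f,u,w)$ outputs $G-u$ and the function $f' \colon V(G-u) \to \mathbb{Z}$ with $f'(v) = f(v)-1$ if $uv \in E(G)$ and $v \ne w$, and $f'(v) = f(v)$ otherwise; it is legal if $f(u) > f(w)$ and $f' \ge 0$. The graph $G$ is weakly $f$-degenerate if all its vertices can be removed by a sequence of legal applications of these two operations, starting from $(G,f)$. The weak degeneracy $\mathsf{wd}(G)$ is the minimum $d \in \mathbb{N}$ such that $G$ is weakly degenerate with respect to the constant function $d$. **Theorem.** There exist $c > 0$ and $d_0 \in \mathbb{N}$ such that if $G$ is a graph of maximum degree $d \ge d_0$ and girth at least $5$, then $\mathsf{wd}(G)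 \le d - c\sqrt{d}$. -/

import Mathlib

namespace WeakDegeneracy

variable {V : Type*}

open Classical in
/-- The function produced by the operation `Delete(G, f, u)`: every neighbour of `u` loses `1`. -/
noncomputable def deleteFun (G : SimpleGraph V) (f : V → ℤ) (u : V) : V → ℤ :=
  fun v => if G.Adj u v then f v - 1 else f v

open Classical in
/-- The function produced by the operation `DelSave(G, f, u, w)`: every neighbour of `u` other
than `w` loses `1`. -/
noncomputable def delSaveFun (G : SimpleGraph V) (f : V → ℤ) (u w : V) : V → ℤ :=
  fun v => if G.Adj u v ∧ v ≠ w then f v - 1 else f v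

/-- One legal application of `Delete` or `DelSave`. A state `(S, f)` stands for the induced subgraph
`G[S]` on the vertices not yet removed together with the restriction of `f` to `S`; the values of
`f` outside `S` play no role. -/
inductive LegalStep (G : SimpleGraph V) : Set V × (V → ℤ) → Set V × (V → ℤ) → Prop
  | delete (S : Set V) (f : V → ℤ) (u : V) (hu : u ∈ S)
      (hnonneg : ∀ v ∈ S \ {u}, 0 ≤ deleteFun G f u v) :
      LegalStep G (S, f) (S \ {u}, deleteFun G f u)
  | delSave (S : Set V) (f : V → ℤ) (u w : V) (hu : u ∈ S) (hw : w ∈ S) (huw : G.Adj u w)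
      (hlt : f w < f u) (hnonneg : ∀ v ∈ S \ {u}, 0 ≤ delSaveFun G f u w v) :
      LegalStep G (S, f) (S \ {u}, delSaveFun G f u w)

/-- `G` is weakly `f`-degenerate: all vertices can be removed by a finite sequence of legal
applications of `Delete` and `DelSave`, starting from `(G, f)`. -/
def IsWeaklyDegenerate (G : SimpleGraph V) (f : V → ℕ) : Prop :=
  ∃ g : V → ℤ, Relation.ReflTransGen (LegalStep G) (Set.univ, fun v => (f v : ℤ)) (∅, g)

/-- The weak degeneracy of `G`: the least `d` such that `G` is weakly degenerate with respect to
the constant function `d`. For finite graphs this minimum exists, see `isLeast_weakDegeneracy`. -/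
noncomputable def weakDegeneracy (G : SimpleGraph V) : ℕ :=
  sInf {d : ℕ | IsWeaklyDegenerate G (fun _ => d)}

theorem exists_removal (G : SimpleGraph V) (n : ℕ) :
    ∀ (S : Set V) (f : V → ℤ), S.Finite → S.ncard = n → (∀ v ∈ S, (n : ℤ) ≤ f v) →
      ∃ g : V → ℤ, Relation.ReflTransGen (LegalStep G) (S, f) (∅, g) := by
  induction n with
  | zero =>
    intro S f hS hn _
    rw [Set.ncard_eq_zero hS] at hn
    subst hn
    exact ⟨f, Relation.ReflTransGen.refl⟩
  | succ n ih =>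
    intro S f hS hn hf
    obtain ⟨u, hu⟩ : S.Nonempty := by
      rw [← Set.ncard_pos hS]
      omega
    have key : ∀ v ∈ S \ {u}, (n : ℤ) ≤ deleteFun G f u v := by
      intro v hv
      have h := hf v hv.1
      push_cast at h
      unfold deleteFun
      split_ifs <;> omega
    obtain ⟨g, hg⟩ := ih (S \ {u}) (deleteFun G f u) (hS.subset Set.sdiff_subset)
      (by rw [Set.ncard_sdiff_singleton_of_mem hu]; omega) key
    exact ⟨g, Relation.ReflTransGen.head
      (LegalStep.delete S f u hu fun v hv => le_trans (by positivity) (key v hv)) hg⟩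

theorem isLeast_weakDegeneracy [Finite V] (G : SimpleGraph V) :
    IsLeast {d : ℕ | IsWeaklyDegenerate G (fun _ => d)} (weakDegeneracy G) := by
  have hne : {d : ℕ | IsWeaklyDegenerate G (fun _ => d)}.Nonempty :=
    ⟨(Set.univ : Set V).ncard, exists_removal G _ Set.univ _ Set.finite_univ rfl fun _ _ => le_rfl⟩
  exact ⟨Nat.sInf_mem hne, fun _ hd => Nat.sInf_le hd⟩

end WeakDegeneracy

/-!
Passing to a core, one may assume that all degrees lie between `d - k` and `d`, where `k` is a small
multiple of `√d`. Give every vertex an independent uniform removal time in `{0, …, d - 1}` and mark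
it with probability of order `1 / k`. At time `t` a vertex expects to have lost about `t`
neighbours, with fluctuations of order `√d`. So with constant probability the neighbourhood of a
vertex `w` is ahead by a large multiple of `k` at a constant proportion of the removal times of its
members; the marked vertices for which this happens are reserved. Girth five makes the
neighbourhoods of the neighbours of a vertex disjoint, hence nearly independent, so the local lemma
yields times for which every vertex has at least `k` and at most `O(k)` reserved neighbours, and
every reserved vertex `w` has `Ω(d)` neighbours `u` that are not behind when `w` is far ahead.
By Hall's theorem each reserved vertex gets `k` such neighbours of its own, which are removed by
`DelSave(u, w)`. Removing the reserved vertices last, every other vertex keeps `k` units because of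
its reserved neighbours, and every reserved vertex because it was saved `k` times.
-/

namespace WeakDegeneracy

open Finset
open scoped BigOperators

section Removal

variable {V : Type*} {G : SimpleGraph V}

/-- All vertices of `G[S]` can be removed by legal operations, starting from the function `f`. As
in `LegalStep`, the values of `f` outside `S` play no role. -/
def Removable (G : SimpleGraph V) (S : Set V) (f : V → ℤ) : Prop :=
  ∃ g : V → ℤ, Relation.ReflTransGen (LegalStep G) (S, f) (∅, g)

theorem ncard_sdiff_inter_neighborSet_le [Finite V] {S : Set V} {f g : V → ℤ} {u v : V}
    (hu : u ∈ S) (hf : ((S ∩ G.neighborSet v).ncard : ℤ) ≤ f v) (hle : f v - 1 ≤ g v)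
    (hadj : ¬ G.Adj u v → f v ≤ g v) :
    (((S \ {u}) ∩ G.neighborSet v).ncard : ℤ) ≤ g v := by
  rw [Set.sdiff_inter_right_comm]
  by_cases huv : G.Adj u v
  · have := Set.ncard_sdiff_singleton_add_one (s := S ∩ G.neighborSet v) ⟨hu, huv.symm⟩
    lia
  · have := Set.ncard_le_ncard (Set.sdiff_subset (s := S ∩ G.neighborSet v) (t := {u}))
    have := hadj huv
    lia

theorem LegalStep.insert_vertex [Finite V] {S T : Set V} {f g : V → ℤ} {v : V}
    (h : LegalStep G (S, f) (T, g)) (hv : v ∉ S) (hf : ((S ∩ G.neighborSet v).ncard : ℤ) ≤ f v) :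
    LegalStep G (insert v S, f) (insert v T, g) ∧
      v ∉ T ∧ ((T ∩ G.neighborSet v).ncard : ℤ) ≤ g v := by
  cases h with
  | delete _ _ u hu hnonneg =>
    have hcount := ncard_sdiff_inter_neighborSet_le (g := deleteFun G f u) hu hf
      (by unfold deleteFun; split_ifs <;> lia) (by unfold deleteFun; simp +contextual)
    rw [Set.insert_sdiff_singleton_comm (ne_of_mem_of_not_mem hu hv).symm]
    refine ⟨.delete _ f u (Or.inr hu) ?_, fun hvS => hv hvS.1, hcount⟩
    rw [← Set.insert_sdiff_singleton_comm (ne_of_mem_of_not_mem hu hv).symm]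
    exact Set.forall_mem_insert.mpr ⟨by lia, hnonneg⟩
  | delSave _ _ u w hu hw huw hlt hnonneg =>
    have hcount := ncard_sdiff_inter_neighborSet_le (g := delSaveFun G f u w) hu hf
      (by unfold delSaveFun; split_ifs <;> lia) (by unfold delSaveFun; simp +contextual)
    rw [Set.insert_sdiff_singleton_comm (ne_of_mem_of_not_mem hu hv).symm]
    refine ⟨.delSave _ f u w (Or.inr hu) (Or.inr hw) huw hlt ?_, fun hvS => hv hvS.1, hcount⟩
    rw [← Set.insert_sdiff_singleton_comm (ne_of_mem_of_not_mem hu hv).symm]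
    exact Set.forall_mem_insert.mpr ⟨by lia, hnonneg⟩

theorem Removable.insert_vertex [Finite V] {S : Set V} {f : V → ℤ} {v : V} (h : Removable G S f)
    (hv : v ∉ S) (hf : ((S ∩ G.neighborSet v).ncard : ℤ) ≤ f v) :
    Removable G (insert v S) f := by
  obtain ⟨g, hg⟩ := h
  suffices H : ∀ s : Set V × (V → ℤ), Relation.ReflTransGen (LegalStep G) s (∅, g) → v ∉ s.1 →
      ((s.1 ∩ G.neighborSet v).ncard : ℤ) ≤ s.2 v → Removable G (insert v s.1) s.2 from
    H _ hg hv hf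
  intro s hs
  induction hs using Relation.ReflTransGen.head_induction_on with
  | refl =>
    intro _ _
    have hlast := LegalStep.delete (G := G) {v} g v rfl (by simp)
    rw [Set.sdiff_self] at hlast
    exact ⟨_, .single (by simpa using hlast)⟩
  | head hstep _ ih =>
    intro hv hf
    obtain ⟨hstep', hv', hf'⟩ := hstep.insert_vertex hv hf
    obtain ⟨g', hg'⟩ := ih hv' hf'
    exact ⟨g', .head hstep' hg'⟩

theorem LegalStep.exists_of_induce {S : Set V} {R T : Set S} {f : V → ℤ} {g : S → ℤ}
    (h : LegalStep (G.induce S) (R, fun v => f v) (T, g)) :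
    ∃ f' : V → ℤ, g = (fun v : S => f' v) ∧
      LegalStep G (Subtype.val '' R, f) (Subtype.val '' T, f') := by
  cases h with
  | delete _ _ u hu hnonneg =>
    refine ⟨deleteFun G f u, rfl, ?_⟩
    rw [Set.image_sdiff Subtype.val_injective, Set.image_singleton]
    refine .delete _ f u (Set.mem_image_of_mem _ hu) ?_
    rintro _ ⟨⟨v, hv, rfl⟩, hvu⟩
    exact hnonneg v ⟨hv, fun h => hvu (congrArg Subtype.val h)⟩
  | delSave _ _ u w hu hw huw hlt hnonneg =>
    have hfun : delSaveFun (G.induce S) (fun v => f v) u w = fun v : S => delSaveFun G f u w v := by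
      funext v
      unfold delSaveFun
      congr 1
      exact propext (and_congr_right' Subtype.ext_iff.not)
    rw [hfun] at hnonneg ⊢
    refine ⟨delSaveFun G f u w, rfl, ?_⟩
    rw [Set.image_sdiff Subtype.val_injective, Set.image_singleton]
    refine .delSave _ f u w (Set.mem_image_of_mem _ hu) (Set.mem_image_of_mem _ hw) huw hlt ?_
    rintro _ ⟨⟨v, hv, rfl⟩, hvu⟩
    exact hnonneg v ⟨hv, fun h => hvu (congrArg Subtype.val h)⟩

theorem IsWeaklyDegenerate.removable_of_induce {S : Set V} {f : V → ℕ}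
    (h : IsWeaklyDegenerate (G.induce S) fun v => f v) : Removable G S fun v => f v := by
  obtain ⟨g, hg⟩ := h
  suffices H : ∀ s : Set S × (S → ℤ), Relation.ReflTransGen (LegalStep (G.induce S)) s (∅, g) →
      ∀ f : V → ℤ, s.2 = (fun v : S => f v) → Removable G (Subtype.val '' s.1) f by
    simpa using H _ hg (fun v => f v) rfl
  intro s hs
  induction hs using Relation.ReflTransGen.head_induction_on with
  | refl => exact fun f _ => ⟨f, by simpa using .refl⟩
  | @head s _ hstep _ ih =>
    obtain ⟨R, f₀⟩ := s
    rintro f rfl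
    obtain ⟨f', hf', hstep'⟩ := hstep.exists_of_induce
    obtain ⟨g', hg'⟩ := ih f' hf'
    exact ⟨g', .head hstep' hg'⟩

/-- A subgraph with minimum degree at most `D` can be removed by leaving a vertex of degree at most
`D` to the end, so only the cores of `G` matter. -/
theorem isWeaklyDegenerate_of_forall_induce [Finite V] {D : ℕ}
    (h : ∀ S : Set V, (∀ v : S, D < ((G.induce S).neighborSet v).ncard) →
      IsWeaklyDegenerate (G.induce S) fun _ => D) :
    IsWeaklyDegenerate G fun _ => D := by
  suffices H : ∀ S : Set V, Removable G S fun _ => D from H Set.univ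
  intro S
  induction S using WellFoundedLT.induction with
  | ind S ih =>
    by_cases hdeg : ∀ v : S, D < ((G.induce S).neighborSet v).ncard
    · exact (h S hdeg).removable_of_induce
    · push Not at hdeg
      obtain ⟨v, hv⟩ := hdeg
      have himage : (S \ {(v : V)}) ∩ G.neighborSet v ⊆
          Subtype.val '' (G.induce S).neighborSet v := fun x hx => ⟨⟨x, hx.1.1⟩, hx.2, rfl⟩
      have hcard : ((S \ {(v : V)}) ∩ G.neighborSet v).ncard ≤ D :=
        (Set.ncard_le_ncard himage).trans <| (Set.ncard_image_le (Set.toFinite _)).trans hv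
      have hinsert := (ih (S \ {(v : V)}) (Set.sdiff_singleton_ssubset.mpr v.2)).insert_vertex
        (v := (v : V)) (fun hvS => hvS.2 rfl) (by exact_mod_cast hcard)
      rwa [Set.insert_sdiff_singleton, Set.insert_eq_of_mem v.2] at hinsert

open Classical in
/-- The number of units that `v` has lost once the vertices of `R` are removed, where `σ x = some w`
means that `x` is removed by `DelSave(x, w)` and `σ x = none` that it is removed by `Delete(x)`. -/
noncomputable def lost (G : SimpleGraph V) (σ : V → Option V) (R : Finset V) (v : V) : ℕ :=
  #{x ∈ R | G.Adj x v ∧ σ x ≠ some v}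

theorem lost_le_card {σ : V → Option V} {R C : Finset V} {v : V}
    (h : ∀ x ∈ R, G.Adj x v → σ x ≠ some v → x ∈ C) : lost G σ R v ≤ #C := by
  classical
  refine card_le_card fun x hx => ?_
  obtain ⟨hxR, hadj, hσ⟩ := mem_filter.mp hx
  exact h x hxR hadj hσ

theorem card_le_lost {σ : V → Option V} {R C : Finset V} {v : V}
    (h : ∀ x ∈ C, x ∈ R ∧ G.Adj x v ∧ σ x ≠ some v) : #C ≤ lost G σ R v := by
  classical exact card_le_card fun x hx => mem_filter.mpr (h x hx)

theorem lost_mono {σ : V → Option V} {R R' : Finset V} (h : R ⊆ R') (v : V) :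
    lost G σ R v ≤ lost G σ R' v := by
  classical exact card_le_card (filter_subset_filter _ h)

theorem deleteFun_sub_lost [DecidableEq V] {σ : V → Option V} {R : Finset V} {u : V} (D : ℤ)
    (hu : u ∉ R) (hσ : σ u = none) :
    deleteFun G (fun v => D - lost G σ R v) u = fun v => D - lost G σ (insert u R) v := by
  classical
  funext v
  rw [deleteFun, lost, lost, filter_insert]
  by_cases huv : G.Adj u v
  · rw [if_pos huv, if_pos ⟨huv, by simp [hσ]⟩, card_insert_of_notMem (by simp [hu])]
    lia
  · rw [if_neg huv, if_neg fun h => huv h.1]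

theorem delSaveFun_sub_lost [DecidableEq V] {σ : V → Option V} {R : Finset V} {u w : V} (D : ℤ)
    (hu : u ∉ R) (hσ : σ u = some w) :
    delSaveFun G (fun v => D - lost G σ R v) u w = fun v => D - lost G σ (insert u R) v := by
  classical
  funext v
  have hiff : G.Adj u v ∧ v ≠ w ↔ G.Adj u v ∧ σ u ≠ some v := by simp [hσ, eq_comm]
  rw [delSaveFun, lost, lost, filter_insert]
  by_cases huv : G.Adj u v ∧ v ≠ w
  · rw [if_pos huv, if_pos (hiff.mp huv), card_insert_of_notMem (by simp [hu])]
    lia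
  · rw [if_neg huv, if_neg (hiff.not.mp huv)]

theorem legalStep_of_lost [DecidableEq V] {σ : V → Option V} {R : Finset V} {u : V} {D : ℕ}
    (hu : u ∉ R) (hle : ∀ v ∉ R, v ≠ u → lost G σ (insert u R) v ≤ D)
    (hσ : ∀ w, σ u = some w → w ∉ R ∧ G.Adj u w ∧ lost G σ R u < lost G σ R w) :
    LegalStep G ((R : Set V)ᶜ, fun v => (D : ℤ) - lost G σ R v)
      (((insert u R : Finset V) : Set V)ᶜ, fun v => (D : ℤ) - lost G σ (insert u R) v) := by
  have hset : ((insert u R : Finset V) : Set V)ᶜ = (R : Set V)ᶜ \ {u} := by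
    ext x
    simp [and_comm]
  have hnonneg : ∀ v ∈ (R : Set V)ᶜ \ {u}, 0 ≤ (D : ℤ) - lost G σ (insert u R) v := by
    rintro v ⟨hvR, hvu⟩
    have := hle v hvR hvu
    lia
  rw [hset]
  cases hu' : σ u with
  | none =>
    have hfun := deleteFun_sub_lost (G := G) D hu hu'
    simp_rw [← congrFun hfun] at hnonneg
    rw [← hfun]
    exact .delete _ _ u hu hnonneg
  | some w =>
    obtain ⟨hwR, huw, hlt⟩ := hσ w hu'
    have hfun := delSaveFun_sub_lost (G := G) D hu hu'
    simp_rw [← congrFun hfun] at hnonneg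
    rw [← hfun]
    exact .delSave _ _ u w hu hwR huw (by simpa using hlt) hnonneg

/-- Vertices are removed in the order of their rank `τ`, with ties broken arbitrarily; the
hypotheses hold for every way of breaking ties. -/
theorem isWeaklyDegenerate_of_rank [Fintype V] {L : Type*} [LinearOrder L] {D : ℕ} (τ : V → L)
    (σ : V → Option V) (hle : ∀ v, lost G σ {x | τ x ≤ τ v} v ≤ D)
    (hσ : ∀ u w, σ u = some w → G.Adj u w ∧ τ u < τ w ∧
      lost G σ {x | τ x ≤ τ u} u < lost G σ {x | τ x < τ u} w) :
    IsWeaklyDegenerate G fun _ => D := by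
  classical
  suffices H : ∀ R : Finset V, (∀ x ∈ R, ∀ y ∉ R, τ x ≤ τ y) →
      Removable G (R : Set V)ᶜ fun v => D - lost G σ R v by
    change Removable G Set.univ fun _ => (D : ℤ)
    have h₀ := H ∅ (by simp)
    simpa [lost] using h₀
  intro R
  induction R using WellFoundedGT.induction with
  | ind R ih =>
    intro hR
    rcases (Rᶜ).eq_empty_or_nonempty with hempty | hnonempty
    · rw [compl_eq_empty_iff] at hempty
      exact ⟨_, by simpa [hempty] using Relation.ReflTransGen.refl⟩
    obtain ⟨u, hu, hmin⟩ := exists_min_image Rᶜ τ hnonempty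
    simp only [mem_compl] at hu hmin
    have hinsert : ∀ x ∈ insert u R, ∀ y ∉ R, τ x ≤ τ y :=
      (forall_mem_insert u R _).mpr ⟨hmin, hR⟩
    obtain ⟨g, hg⟩ := ih (insert u R) (ssubset_insert hu) fun x hx y hy =>
      hinsert x hx y fun hyR => hy (mem_insert_of_mem hyR)
    refine ⟨g, .head (legalStep_of_lost hu (fun v hv _ => ?_) fun w hw => ?_) hg⟩
    · exact (lost_mono (fun x hx => by simpa using hinsert x hx v hv) v).trans (hle v)
    · obtain ⟨huw, hτ, hlt⟩ := hσ u w hw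
      refine ⟨fun hwR => (hR w hwR u hu).not_gt hτ, huw, ?_⟩
      calc lost G σ R u ≤ lost G σ {x | τ x ≤ τ u} u :=
            lost_mono (fun x hx => by simpa using hR x hx u hu) u
        _ < lost G σ {x | τ x < τ u} w := hlt
        _ ≤ lost G σ R w := lost_mono (fun x hx => by
            by_contra hxR
            exact (hmin x hxR).not_gt (by simpa using hx)) w

end Removal

section Probability

variable {Ω ι : Type*} [Fintype Ω]

open Classical in
/-- The probability of the event `P` under the uniform measure on a finite type. -/
noncomputable def pr (P : Ω → Prop) : ℝ := 𝔼 ω, if P ω then 1 else 0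

theorem pr_eq_expect_ite (P : Ω → Prop) [DecidablePred P] :
    pr P = 𝔼 ω, if P ω then (1 : ℝ) else 0 := by
  unfold pr
  congr! 2

theorem pr_eq_card_div_card (P : Ω → Prop) [DecidablePred P] :
    pr P = #{ω | P ω} / Fintype.card Ω := by
  rw [pr_eq_expect_ite, Fintype.expect_eq_sum_div_card, sum_boole]

theorem expect_fst {Ω' : Type*} [Fintype Ω'] [Nonempty Ω'] (F : Ω → ℝ) :
    𝔼 x : Ω × Ω', F x.1 = 𝔼 ω, F ω := by
  rw [← univ_product_univ, expect_product]
  simp only [Fintype.expect_const]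

theorem pr_fst {Ω' : Type*} [Fintype Ω'] [Nonempty Ω'] (P : Ω → Prop) :
    pr (fun x : Ω × Ω' => P x.1) = pr P := by
  classical exact expect_fst fun ω => if P ω then (1 : ℝ) else 0

theorem pr_snd {Ω' : Type*} [Fintype Ω'] [Nonempty Ω'] (P : Ω → Prop) :
    pr (fun x : Ω' × Ω => P x.2) = pr P :=
  calc pr (fun x : Ω' × Ω => P x.2) = pr fun x : Ω × Ω' => P x.1 :=
        Fintype.expect_equiv (Equiv.prodComm Ω' Ω) _ _ fun _ => rfl
    _ = pr P := pr_fst P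

theorem pr_le_expect {P : Ω → Prop} {F : Ω → ℝ} (h₀ : ∀ ω, 0 ≤ F ω) (h₁ : ∀ ω, P ω → 1 ≤ F ω) :
    pr P ≤ 𝔼 ω, F ω := by
  refine expect_le_expect fun ω _ => ?_
  split_ifs with h
  · exact h₁ ω h
  · exact h₀ ω

theorem pr_nonneg (P : Ω → Prop) : 0 ≤ pr P :=
  expect_nonneg fun ω _ => by split_ifs <;> norm_num

theorem pr_mono {P Q : Ω → Prop} (h : ∀ ω, P ω → Q ω) : pr P ≤ pr Q :=
  pr_le_expect (fun ω => by split_ifs <;> norm_num) fun ω hω => by rw [if_pos (h ω hω)]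

theorem pr_or_le (P Q : Ω → Prop) : pr (fun ω => P ω ∨ Q ω) ≤ pr P + pr Q := by
  rw [pr, pr, pr, ← expect_add_distrib]
  refine expect_le_expect fun ω _ => ?_
  by_cases hP : P ω <;> by_cases hQ : Q ω <;> simp [hP, hQ]

theorem pr_not [Nonempty Ω] (P : Ω → Prop) : pr (fun ω => ¬ P ω) = 1 - pr P := by
  classical
  have h : ∀ ω, (if ¬ P ω then (1 : ℝ) else 0) = 1 - if P ω then 1 else 0 := fun ω => by
    split_ifs <;> norm_num
  simp only [pr_eq_expect_ite, h]
  rw [expect_sub_distrib, Fintype.expect_const]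

theorem pr_false : pr (fun _ : Ω => False) = 0 := by simp [pr]

theorem pr_true [Nonempty Ω] : pr (fun _ : Ω => True) = 1 := by simp [pr]

theorem pr_exists_mem_le_sum (A : ι → Ω → Prop) (I : Finset ι) :
    pr (fun ω => ∃ i ∈ I, A i ω) ≤ ∑ i ∈ I, pr (A i) := by
  classical
  induction I using Finset.induction_on with
  | empty => simp [pr_false]
  | insert i I hi ih =>
    simp only [exists_mem_insert, sum_insert hi]
    exact (pr_or_le _ _).trans (by gcongr)

theorem sum_pr_le_add_card_mul_pr [Nonempty Ω] (A : ι → Ω → Prop) [∀ i ω, Decidable (A i ω)]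
    (I : Finset ι) {m : ℝ} (hm : 0 ≤ m) :
    ∑ i ∈ I, pr (A i) ≤ m + #I * pr (fun ω => m ≤ #{i ∈ I | A i ω}) := by
  classical
  calc ∑ i ∈ I, pr (A i) = 𝔼 ω, (#{i ∈ I | A i ω} : ℝ) := by
        simp only [pr_eq_expect_ite, ← expect_sum_comm, sum_boole]
    _ ≤ 𝔼 ω, (m + #I * if m ≤ (#{i ∈ I | A i ω} : ℝ) then 1 else 0) := by
        refine expect_le_expect fun ω _ => ?_
        have hcard : (#{i ∈ I | A i ω} : ℝ) ≤ #I := mod_cast card_filter_le _ _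
        split_ifs <;> linarith
    _ = m + #I * pr (fun ω => m ≤ #{i ∈ I | A i ω}) := by
        rw [expect_add_distrib, Fintype.expect_const, ← mul_expect, pr_eq_expect_ite]

end Probability

section Product

variable {V α ι : Type*} [Fintype V] [DecidableEq V] [Fintype α] [Nonempty α]

theorem expect_eval (v : V) (F : α → ℝ) : 𝔼 ω : V → α, F (ω v) = 𝔼 a, F a :=
  calc 𝔼 ω : V → α, F (ω v) = 𝔼 x : α × ({u // u ≠ v} → α), F x.1 :=
        Fintype.expect_equiv (Equiv.funSplitAt v α) _ _ fun _ => rfl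
    _ = 𝔼 a, F a := expect_fst F

theorem pr_eval (v : V) (A : α → Prop) : pr (fun ω : V → α => A (ω v)) = pr A := by
  classical exact expect_eval v fun a => if A a then (1 : ℝ) else 0

theorem expect_piecewise (S : Finset V) (F : (V → α) → ℝ) :
    𝔼 ω, F ω = 𝔼 ω : V → α, 𝔼 ω' : V → α, F (S.piecewise ω ω') := by
  let swap : (V → α) × (V → α) → (V → α) × (V → α) :=
    fun x => (S.piecewise x.1 x.2, S.piecewise x.2 x.1)
  have hswap : Function.Involutive swap := by
    rintro ⟨ω, ω'⟩
    simp only [swap, Prod.mk.injEq]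
    constructor <;> funext v <;> by_cases hv : v ∈ S <;> simp [hv]
  calc 𝔼 ω, F ω = 𝔼 x : (V → α) × (V → α), F x.1 := (expect_fst F).symm
    _ = 𝔼 x : (V → α) × (V → α), F (S.piecewise x.1 x.2) :=
        (Fintype.expect_bijective swap hswap.bijective _ _ fun _ => rfl).symm
    _ = 𝔼 ω : V → α, 𝔼 ω' : V → α, F (S.piecewise ω ω') := by
        rw [← univ_product_univ, expect_product]

theorem pr_eq_expect_pr_piecewise (S : Finset V) (P : (V → α) → Prop) :
    pr P = 𝔼 ω : V → α, pr fun ω' : V → α => P (S.piecewise ω ω') := by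
  classical exact expect_piecewise S fun ω => if P ω then (1 : ℝ) else 0

theorem expect_mul_of_dependsOn {F H : (V → α) → ℝ} {S T : Finset V} (hF : DependsOn F S)
    (hH : DependsOn H T) (hST : Disjoint S T) :
    𝔼 ω, F ω * H ω = (𝔼 ω, F ω) * 𝔼 ω, H ω := by
  rw [expect_piecewise S, expect_mul_expect]
  refine expect_congr rfl fun ω _ => expect_congr rfl fun ω' _ => ?_
  congr 1
  · exact hF fun v hv => piecewise_eq_of_mem _ _ _ (mem_coe.mp hv)
  · exact hH fun v hv => piecewise_eq_of_notMem _ _ _ (disjoint_right.mp hST (mem_coe.mp hv))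

theorem expect_prod_of_dependsOn {F : ι → (V → α) → ℝ} {D : ι → Finset V} {I : Finset ι}
    (hF : ∀ i ∈ I, DependsOn (F i) (D i)) (hD : (I : Set ι).PairwiseDisjoint D) :
    𝔼 ω, ∏ i ∈ I, F i ω = ∏ i ∈ I, 𝔼 ω, F i ω := by
  classical
  induction I using Finset.induction_on with
  | empty => simp
  | insert i I hi ih =>
    have hFI : ∀ j ∈ I, DependsOn (F j) (D j) := fun j hj => hF j (mem_insert_of_mem hj)
    have hprod : DependsOn (fun ω => ∏ j ∈ I, F j ω) (I.biUnion D : Finset V) := fun _ _ h =>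
      prod_congr rfl fun j hj => hFI j hj fun v hv => h v (mem_biUnion.mpr ⟨j, hj, hv⟩)
    simp only [prod_insert hi]
    rw [← ih hFI (hD.subset (by simp))]
    refine expect_mul_of_dependsOn (hF i (mem_insert_self i I)) hprod ?_
    rw [disjoint_biUnion_right]
    exact fun j hj => hD (by simp) (by simp [hj]) (ne_of_mem_of_not_mem hj hi).symm

theorem pr_and_of_dependsOn {P Q : (V → α) → Prop} {S T : Finset V} (hP : DependsOn P S)
    (hQ : DependsOn Q T) (hST : Disjoint S T) : pr (fun ω => P ω ∧ Q ω) = pr P * pr Q := by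
  classical
  rw [pr, pr, pr, ← expect_mul_of_dependsOn (fun _ _ h => by simp only [hP h])
    (fun _ _ h => by simp only [hQ h]) hST]
  refine expect_congr rfl fun ω _ => ?_
  by_cases hPω : P ω <;> by_cases hQω : Q ω <;> simp [hPω, hQω]

theorem pr_le_of_forall_pr_piecewise_le (S : Finset V) {P : (V → α) → Prop} {c : ℝ}
    (h : ∀ ω : V → α, pr (fun ω' => P (S.piecewise ω ω')) ≤ c) : pr P ≤ c := by
  rw [pr_eq_expect_pr_piecewise S]
  exact expect_le univ_nonempty fun ω _ => h ω

theorem mul_pr_le_pr_and {A : α → Prop} {Q : α → (V → α) → Prop} {S : Finset V} {u : V} {q : ℝ}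
    (hu : u ∉ S) (hQ : ∀ a, DependsOn (Q a) S) (h : ∀ a, A a → q ≤ pr (Q a)) :
    q * pr A ≤ pr fun ω => A (ω u) ∧ Q (ω u) ω := by
  classical
  calc q * pr A = 𝔼 ω : V → α, q * if A (ω u) then 1 else 0 := by
        rw [← mul_expect, ← pr_eq_expect_ite, pr_eval]
    _ ≤ 𝔼 ω : V → α, pr fun ω' : V → α => A (ω u) ∧ Q (ω u) ω' := by
        refine expect_le_expect fun ω _ => ?_
        by_cases hA : A (ω u)
        · simpa [hA] using h (ω u) hA
        · simp [hA, pr_false]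
    _ = pr fun ω => A (ω u) ∧ Q (ω u) ω := by
        rw [pr_eq_expect_pr_piecewise {u}]
        refine expect_congr rfl fun ω _ => congrArg pr (funext fun ω' => ?_)
        have hQu : Q (ω u) ω' = Q (ω u) (piecewise {u} ω ω') := hQ (ω u) fun v hv =>
          (piecewise_eq_of_notMem {u} ω ω' fun hvu => hu (mem_singleton.mp hvu ▸ hv)).symm
        rw [hQu, piecewise_eq_of_mem _ _ _ (mem_singleton_self u)]

theorem expect_exp_mul_card_le {A : ι → (V → α) → Prop} [∀ i ω, Decidable (A i ω)]
    {D : ι → Finset V} {I : Finset ι} (hA : ∀ i ∈ I, DependsOn (A i) (D i))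
    (hD : (I : Set ι).PairwiseDisjoint D) (c : ℝ) :
    𝔼 ω, Real.exp (c * #{i ∈ I | A i ω}) ≤ Real.exp ((Real.exp c - 1) * ∑ i ∈ I, pr (A i)) := by
  have hprod (ω : V → α) :
      Real.exp (c * #{i ∈ I | A i ω}) = ∏ i ∈ I, if A i ω then Real.exp c else 1 := by
    rw [prod_ite, prod_const, prod_const_one, mul_one, mul_comm, Real.exp_nat_mul]
  have hfactor (i : ι) :
      𝔼 ω, (if A i ω then Real.exp c else 1) = 1 + (Real.exp c - 1) * pr (A i) := by
    have h : ∀ ω, (if A i ω then Real.exp c else 1) =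
        1 + (Real.exp c - 1) * if A i ω then 1 else 0 := fun ω => by split_ifs <;> ring
    simp only [h]
    rw [expect_add_distrib, Fintype.expect_const, ← mul_expect, pr_eq_expect_ite]
  simp only [hprod]
  rw [expect_prod_of_dependsOn (fun i hi _ _ h => by simp only [hA i hi h]) hD, mul_sum,
    Real.exp_sum]
  refine prod_le_prod (fun i _ => expect_nonneg fun ω _ => by positivity) fun i _ => ?_
  rw [hfactor, add_comm]
  exact Real.add_one_le_exp _

theorem pr_card_lt_le_exp {A : ι → (V → α) → Prop} [∀ i ω, Decidable (A i ω)]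
    {D : ι → Finset V} {I : Finset ι} (hA : ∀ i ∈ I, DependsOn (A i) (D i))
    (hD : (I : Set ι).PairwiseDisjoint D) {μ : ℝ} (hμ₀ : 0 ≤ μ) (hμ : μ ≤ ∑ i ∈ I, pr (A i)) :
    pr (fun ω => (#{i ∈ I | A i ω} : ℝ) < μ / 4) ≤ Real.exp (-(μ / 4)) := by
  have hexp : Real.exp (-1) ≤ 1 / 2 := by
    rw [Real.exp_neg, inv_eq_one_div]
    exact one_div_le_one_div_of_le two_pos (by linarith [Real.exp_one_gt_d9])
  calc pr (fun ω => (#{i ∈ I | A i ω} : ℝ) < μ / 4)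
      ≤ 𝔼 ω, Real.exp (μ / 4) * Real.exp (-1 * #{i ∈ I | A i ω}) := by
        refine pr_le_expect (fun ω => by positivity) fun ω hω => ?_
        rw [← Real.exp_add]
        exact Real.one_le_exp (by linarith)
    _ ≤ Real.exp (μ / 4) * Real.exp ((Real.exp (-1) - 1) * ∑ i ∈ I, pr (A i)) := by
        rw [← mul_expect]
        gcongr
        exact expect_exp_mul_card_le hA hD (-1)
    _ ≤ Real.exp (-(μ / 4)) := by
        rw [← Real.exp_add, Real.exp_le_exp]
        nlinarith

theorem pr_lt_card_le_exp {A : ι → (V → α) → Prop} [∀ i ω, Decidable (A i ω)]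
    {D : ι → Finset V} {I : Finset ι} (hA : ∀ i ∈ I, DependsOn (A i) (D i))
    (hD : (I : Set ι).PairwiseDisjoint D) {m : ℝ} (hm : 4 * ∑ i ∈ I, pr (A i) ≤ m) :
    pr (fun ω => m < (#{i ∈ I | A i ω} : ℝ)) ≤ Real.exp (-(m / 2)) := by
  calc pr (fun ω => m < (#{i ∈ I | A i ω} : ℝ))
      ≤ 𝔼 ω, Real.exp (-m) * Real.exp (1 * #{i ∈ I | A i ω}) := by
        refine pr_le_expect (fun ω => by positivity) fun ω hω => ?_
        rw [← Real.exp_add]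
        exact Real.one_le_exp (by linarith)
    _ ≤ Real.exp (-m) * Real.exp ((Real.exp 1 - 1) * ∑ i ∈ I, pr (A i)) := by
        rw [← mul_expect]
        gcongr
        exact expect_exp_mul_card_le hA hD 1
    _ ≤ Real.exp (-(m / 2)) := by
        rw [← Real.exp_add, Real.exp_le_exp]
        have hsum : 0 ≤ ∑ i ∈ I, pr (A i) := sum_nonneg fun i _ => pr_nonneg _
        nlinarith [Real.exp_one_lt_d9]

end Product

section LocalLemma

variable {V α ι : Type*} [Fintype V] [DecidableEq V] [Fintype α] [Nonempty α] [Fintype ι]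
  {A : ι → (V → α) → Prop} {D : ι → Finset V} {p : ℝ} {Δ : ℕ}

theorem pr_and_forall_not_le (hA : ∀ i, DependsOn (A i) (D i)) (hp : ∀ i, pr (A i) ≤ p)
    (hΔ : ∀ i, #{j | ¬ Disjoint (D i) (D j)} ≤ Δ) (h : 4 * p * Δ ≤ 1) (J : Finset ι) (i : ι) :
    pr (fun ω => A i ω ∧ ∀ j ∈ J, ¬ A j ω) ≤ 2 * p * pr (fun ω => ∀ j ∈ J, ¬ A j ω) := by
  induction J using Finset.strongInduction generalizing i with
  | H J ih =>
    have hp₀ : 0 ≤ p := (pr_nonneg _).trans (hp i)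
    set far := {j ∈ J | Disjoint (D i) (D j)}
    set near := {j ∈ J | ¬ Disjoint (D i) (D j)}
    set avoid : Finset ι → (V → α) → Prop := fun J ω => ∀ j ∈ J, ¬ A j ω
    have hfirst : pr (fun ω => A i ω ∧ avoid J ω) ≤ p * pr (avoid far) := by
      have hdepends : DependsOn (avoid far) (far.biUnion D : Finset V) := fun _ _ h =>
        propext <| forall₂_congr fun j hj => not_congr <| iff_of_eq <|
          hA j fun v hv => h v (mem_biUnion.mpr ⟨j, hj, hv⟩)
      calc pr (fun ω => A i ω ∧ avoid J ω) ≤ pr (fun ω => A i ω ∧ avoid far ω) :=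
            pr_mono fun ω hω => ⟨hω.1, fun j hj => hω.2 j (mem_of_mem_filter j hj)⟩
        _ = pr (A i) * pr (avoid far) := pr_and_of_dependsOn (hA i) hdepends <|
            (disjoint_biUnion_right _ _ _).mpr fun j hj => (mem_filter.mp hj).2
        _ ≤ p * pr (avoid far) := mul_le_mul_of_nonneg_right (hp i) (pr_nonneg _)
    have hsplit : pr (avoid far) ≤ pr (avoid J) + ∑ j ∈ near, pr (fun ω => A j ω ∧ avoid far ω) :=
      calc pr (avoid far)
          ≤ pr (fun ω => avoid J ω ∨ ∃ j ∈ near, A j ω ∧ avoid far ω) := by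
            refine pr_mono fun ω hω => or_iff_not_imp_right.mpr fun hno j hj hAj => ?_
            by_cases hij : Disjoint (D i) (D j)
            · exact hω j (mem_filter.mpr ⟨hj, hij⟩) hAj
            · exact hno ⟨j, mem_filter.mpr ⟨hj, hij⟩, hAj, hω⟩
        _ ≤ _ := (pr_or_le _ _).trans (add_le_add_right (pr_exists_mem_le_sum _ _) _)
    have hsum : ∑ j ∈ near, pr (fun ω => A j ω ∧ avoid far ω) ≤ Δ * (2 * p * pr (avoid far)) :=
      calc ∑ j ∈ near, pr (fun ω => A j ω ∧ avoid far ω)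
          ≤ #near • (2 * p * pr (avoid far)) := sum_le_card_nsmul _ _ _ fun j hj =>
            ih far (filter_ssubset.mpr ⟨j, mem_filter.mp hj⟩) j
        _ ≤ Δ * (2 * p * pr (avoid far)) := by
            rw [nsmul_eq_mul]
            have := pr_nonneg (avoid far)
            gcongr
            exact (card_le_card (filter_subset_filter _ (subset_univ J))).trans (hΔ i)
    have hhalf : pr (avoid far) ≤ 2 * pr (avoid J) := by
      have := mul_le_mul_of_nonneg_right h (pr_nonneg (avoid far))
      linarith
    calc pr (fun ω => A i ω ∧ avoid J ω) ≤ p * (2 * pr (avoid J)) := by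
          exact hfirst.trans (by gcongr)
      _ = 2 * p * pr (avoid J) := by ring

/-- The symmetric Lovász local lemma. -/
theorem exists_forall_not_of_dependsOn (hA : ∀ i, DependsOn (A i) (D i)) (hp : ∀ i, pr (A i) ≤ p)
    (hΔ : ∀ i, #{j | ¬ Disjoint (D i) (D j)} ≤ Δ) (hΔ₁ : 1 ≤ Δ) (h : 4 * p * Δ ≤ 1) :
    ∃ ω, ∀ i, ¬ A i ω := by
  classical
  have hpos (J : Finset ι) : 0 < pr fun ω => ∀ j ∈ J, ¬ A j ω := by
    induction J using Finset.induction_on with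
    | empty => simp [pr_true]
    | insert i J _ ih =>
      have hΔ₁' : (1 : ℝ) ≤ Δ := mod_cast hΔ₁
      have hstep := pr_and_forall_not_le hA hp hΔ h J i
      have hunion : pr (fun ω => ∀ j ∈ J, ¬ A j ω) ≤
          pr (fun ω => A i ω ∧ ∀ j ∈ J, ¬ A j ω) + pr (fun ω => ∀ j ∈ insert i J, ¬ A j ω) :=
        (pr_mono fun ω hω => by
          simp only [forall_mem_insert]
          tauto).trans (pr_or_le _ _)
      nlinarith
  by_contra! hex
  refine (hpos univ).ne' ((congrArg pr ?_).trans pr_false)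
  funext ω
  simpa using hex ω

end LocalLemma

section Anticoncentration

variable {V α : Type*} [Fintype V] [DecidableEq V] [Fintype α] [Nonempty α]

theorem expect_sum_eval (f : α → ℝ) (Y : Finset V) :
    𝔼 ω : V → α, ∑ x ∈ Y, f (ω x) = #Y * 𝔼 a, f a := by
  simp only [expect_sum_comm, expect_eval, sum_const, nsmul_eq_mul]

theorem expect_sum_pow_mul_pow (f : α → ℝ) {Y : Finset V} {y : V} (hy : y ∉ Y) (i j : ℕ) :
    𝔼 ω : V → α, (∑ x ∈ Y, f (ω x)) ^ i * f (ω y) ^ j =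
      (𝔼 ω : V → α, (∑ x ∈ Y, f (ω x)) ^ i) * 𝔼 a, f a ^ j := by
  have hsum : DependsOn (fun ω : V → α => (∑ x ∈ Y, f (ω x)) ^ i) Y := fun _ _ h =>
    congrArg (· ^ i) <| sum_congr rfl fun x hx => congrArg f (h x hx)
  have heval : DependsOn (fun ω : V → α => f (ω y) ^ j) ({y} : Finset V) := fun _ _ h =>
    congrArg (f · ^ j) <| h y (by simp)
  rw [expect_mul_of_dependsOn hsum heval (disjoint_singleton_right.mpr hy),
    expect_eval y fun a => f a ^ j]

theorem expect_sum_sq {f : α → ℝ} (hf : 𝔼 a, f a = 0) (Y : Finset V) :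
    𝔼 ω : V → α, (∑ x ∈ Y, f (ω x)) ^ 2 = #Y * 𝔼 a, f a ^ 2 := by
  induction Y using Finset.induction_on with
  | empty => simp
  | insert y Y hy ih =>
    have hexpand (ω : V → α) : (∑ x ∈ insert y Y, f (ω x)) ^ 2 =
        (∑ x ∈ Y, f (ω x)) ^ 2 + 2 * ((∑ x ∈ Y, f (ω x)) ^ 1 * f (ω y) ^ 1) + f (ω y) ^ 2 := by
      rw [sum_insert hy]
      ring
    simp only [hexpand]
    rw [expect_add_distrib, expect_add_distrib, ← mul_expect, expect_sum_pow_mul_pow f hy, ih,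
      expect_eval y fun a => f a ^ 2, card_insert_of_notMem hy]
    simp only [pow_one, hf]
    push_cast
    ring

theorem expect_sum_pow_four_le {f : α → ℝ} (hf : 𝔼 a, f a = 0) (hf₁ : ∀ a, |f a| ≤ 1)
    (Y : Finset V) : 𝔼 ω : V → α, (∑ x ∈ Y, f (ω x)) ^ 4 ≤ 3 * (#Y : ℝ) ^ 2 := by
  have hsq₀ : 0 ≤ 𝔼 a, f a ^ 2 := expect_nonneg fun a _ => sq_nonneg _
  have hsq : 𝔼 a, f a ^ 2 ≤ 1 :=
    expect_le univ_nonempty fun a _ => (sq_le_one_iff_abs_le_one _).mpr (hf₁ a)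
  have hfour : 𝔼 a, f a ^ 4 ≤ 1 := expect_le univ_nonempty fun a _ => by
    rw [← Even.pow_abs (by decide)]
    exact pow_le_one₀ (abs_nonneg _) (hf₁ a)
  induction Y using Finset.induction_on with
  | empty => simp
  | insert y Y hy ih =>
    have hexpand (ω : V → α) : (∑ x ∈ insert y Y, f (ω x)) ^ 4 =
        (∑ x ∈ Y, f (ω x)) ^ 4 + 4 * ((∑ x ∈ Y, f (ω x)) ^ 3 * f (ω y) ^ 1) +
          6 * ((∑ x ∈ Y, f (ω x)) ^ 2 * f (ω y) ^ 2) +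
          4 * ((∑ x ∈ Y, f (ω x)) ^ 1 * f (ω y) ^ 3) + f (ω y) ^ 4 := by
      rw [sum_insert hy]
      ring
    simp only [hexpand]
    rw [expect_add_distrib, expect_add_distrib, expect_add_distrib, expect_add_distrib,
      ← mul_expect, ← mul_expect, ← mul_expect, expect_sum_pow_mul_pow f hy,
      expect_sum_pow_mul_pow f hy, expect_sum_pow_mul_pow f hy, expect_sum_sq hf,
      expect_eval y fun a => f a ^ 4, card_insert_of_notMem hy]
    simp only [pow_one, expect_sum_eval, hf]
    have hcross : (#Y : ℝ) * ((𝔼 a, f a ^ 2) * 𝔼 a, f a ^ 2) ≤ #Y :=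
      mul_le_of_le_one_right (Nat.cast_nonneg _) (mul_le_one₀ hsq hsq₀ hsq)
    push_cast
    linarith

/-- Only the first, second and fourth moments of `x` enter on the left-hand side, so integrating
this inequality bounds a probability from below. -/
theorem quartic_le_indicator (x : ℝ) :
    7 * x + x ^ 2 - x ^ 4 / 48 - 1 / 32 ≤ 64 * (if 1 / 256 ≤ x then 1 else 0) := by
  split_ifs with h
  · nlinarith [sq_nonneg (x ^ 2 - 36), sq_nonneg (x - 6)]
  · push Not at h
    rcases le_or_gt 0 x with h₀ | h₀
    · nlinarith [pow_nonneg h₀ 4, mul_nonneg h₀ h₀]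
    · rcases le_or_gt (-7) x with h₇ | h₇
      · nlinarith [sq_nonneg (x ^ 2)]
      · have : (49 : ℝ) ≤ x ^ 2 := by nlinarith
        nlinarith [sq_nonneg (x ^ 2)]

theorem le_pr_sqrt_card_le_sum {f : α → ℝ} (hf : 𝔼 a, f a = 0) (hf₁ : ∀ a, |f a| ≤ 1)
    (hvar : 1 / 8 ≤ 𝔼 a, f a ^ 2) {Y : Finset V} (hY : Y.Nonempty) :
    1 / 2048 ≤ pr fun ω : V → α => √(#Y : ℝ) / 256 ≤ ∑ x ∈ Y, f (ω x) := by
  have hcard : (0 : ℝ) < #Y := mod_cast hY.card_pos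
  set r := √(#Y : ℝ)
  have hr : 0 < r := Real.sqrt_pos.mpr hcard
  have hr₂ : r ^ 2 = #Y := Real.sq_sqrt hcard.le
  have hfirst : 𝔼 ω : V → α, ∑ x ∈ Y, f (ω x) = 0 := by rw [expect_sum_eval, hf, mul_zero]
  have hsecond : 1 / 8 ≤ 𝔼 ω : V → α, ((∑ x ∈ Y, f (ω x)) / r) ^ 2 := by
    simp only [div_pow]
    rwa [← expect_div, expect_sum_sq hf, hr₂, mul_div_cancel_left₀ _ hcard.ne']
  have hfourth : 𝔼 ω : V → α, ((∑ x ∈ Y, f (ω x)) / r) ^ 4 ≤ 3 := by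
    simp only [div_pow]
    rw [← expect_div, div_le_iff₀ (by positivity), show r ^ 4 = (r ^ 2) ^ 2 by ring, hr₂]
    exact expect_sum_pow_four_le hf hf₁ Y
  have hintegrate := expect_le_expect fun (ω : V → α) (_ : ω ∈ univ) =>
    quartic_le_indicator ((∑ x ∈ Y, f (ω x)) / r)
  rw [expect_sub_distrib, expect_sub_distrib, expect_add_distrib, ← mul_expect, ← mul_expect,
    ← expect_div, ← expect_div, hfirst, zero_div, Fintype.expect_const,
    ← pr_eq_expect_ite] at hintegrate
  have hevent (ω : V → α) : 1 / 256 ≤ (∑ x ∈ Y, f (ω x)) / r ↔ r / 256 ≤ ∑ x ∈ Y, f (ω x) := by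
    rw [le_div_iff₀ hr, one_div_mul_eq_div]
  simp only [hevent] at hintegrate
  linarith

theorem le_pr_add_sqrt_card_le_card {A : α → Prop} [DecidablePred A] (hA : 1 / 5 ≤ pr A)
    (hA' : pr A ≤ 4 / 5) {Y : Finset V} (hY : Y.Nonempty) :
    1 / 2048 ≤ pr fun ω : V → α => pr A * #Y + √(#Y : ℝ) / 256 ≤ #{x ∈ Y | A (ω x)} := by
  have hmean : 𝔼 a, ((if A a then 1 else 0) - pr A) = 0 := by
    rw [expect_sub_distrib, ← pr_eq_expect_ite, Fintype.expect_const, sub_self]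
  have hvar : 𝔼 a, ((if A a then 1 else 0) - pr A) ^ 2 = pr A - pr A ^ 2 := by
    have hsq (a : α) : ((if A a then 1 else 0) - pr A) ^ 2 =
        (1 - 2 * pr A) * (if A a then 1 else 0) + pr A ^ 2 := by split_ifs <;> ring
    simp only [hsq]
    rw [expect_add_distrib, ← mul_expect, ← pr_eq_expect_ite, Fintype.expect_const]
    ring
  refine (le_pr_sqrt_card_le_sum hmean (fun a => ?_) ?_ hY).trans (pr_mono fun ω h => ?_)
  · rw [abs_le]
    split_ifs <;> constructor <;> linarith
  · rw [hvar]
    nlinarith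
  · rw [sum_sub_distrib, sum_boole, sum_const, nsmul_eq_mul] at h
    linarith

theorem le_pr_card_le_sub_sqrt_card {A : α → Prop} [DecidablePred A] (hA : 1 / 5 ≤ pr A)
    (hA' : pr A ≤ 4 / 5) {Y : Finset V} (hY : Y.Nonempty) :
    1 / 2048 ≤ pr fun ω : V → α => #{x ∈ Y | A (ω x)} ≤ pr A * #Y - √(#Y : ℝ) / 256 := by
  refine (le_pr_add_sqrt_card_le_card (A := fun a => ¬ A a) (by rw [pr_not]; linarith)
    (by rw [pr_not]; linarith) hY).trans (pr_mono fun ω h => ?_)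
  have hcard : (#{x ∈ Y | A (ω x)} : ℝ) + #{x ∈ Y | ¬ A (ω x)} = #Y :=
    mod_cast card_filter_add_card_filter_not fun x => A (ω x)
  rw [pr_not] at h
  linarith

end Anticoncentration

section Girth

variable {V : Type*} {G : SimpleGraph V}

theorem not_adj_of_four_le_egirth (hG : 4 ≤ G.egirth) {a b c : V} (hab : G.Adj a b)
    (hbc : G.Adj b c) : ¬ G.Adj c a := by
  intro hca
  have hcycle : (SimpleGraph.Walk.cons hab (.cons hbc (.cons hca .nil))).IsCycle := by
    have := hab.ne
    have := hbc.ne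
    have := hca.ne
    rw [SimpleGraph.Walk.cons_isCycle_iff]
    simp [SimpleGraph.Walk.isPath_def]
    tauto
  have hlength := SimpleGraph.le_egirth.mp hG a _ hcycle
  simp only [SimpleGraph.Walk.length_cons, SimpleGraph.Walk.length_nil] at hlength
  exact absurd hlength (by decide)

theorem eq_of_five_le_egirth (hG : 5 ≤ G.egirth) {a b c e : V} (hac : a ≠ c) (hab : G.Adj a b)
    (hbc : G.Adj b c) (hce : G.Adj c e) (hea : G.Adj e a) : b = e := by
  by_contra hbe
  have hcycle :
      (SimpleGraph.Walk.cons hab (.cons hbc (.cons hce (.cons hea .nil)))).IsCycle := by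
    have := hab.ne
    have := hbc.ne
    have := hce.ne
    have := hea.ne
    rw [SimpleGraph.Walk.cons_isCycle_iff]
    simp [SimpleGraph.Walk.isPath_def]
    tauto
  have hlength := SimpleGraph.le_egirth.mp hG a _ hcycle
  simp only [SimpleGraph.Walk.length_cons, SimpleGraph.Walk.length_nil] at hlength
  exact absurd hlength (by decide)

variable [Fintype V] [DecidableRel G.Adj]

theorem disjoint_neighborFinset (hG : 4 ≤ G.egirth) {u v : V} (huv : G.Adj u v) :
    Disjoint (G.neighborFinset u) (G.neighborFinset v) := by
  simp only [disjoint_left, SimpleGraph.mem_neighborFinset]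
  exact fun x hux hvx => not_adj_of_four_le_egirth hG hux hvx.symm huv.symm

variable [DecidableEq V]

theorem pairwiseDisjoint_erase (hG : 5 ≤ G.egirth) (v : V) :
    (G.neighborFinset v : Set V).PairwiseDisjoint fun w => (G.neighborFinset w).erase v := by
  intro u hu w hw huw
  rw [mem_coe, SimpleGraph.mem_neighborFinset] at hu hw
  simp only [Function.onFun, disjoint_left, mem_erase, SimpleGraph.mem_neighborFinset]
  exact fun x hx hx' => hx.1 (eq_of_five_le_egirth hG huw hx.2 hx'.2.symm hw.symm hu)

theorem pairwiseDisjoint_insert_erase (hG : 5 ≤ G.egirth) (v : V) :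
    (G.neighborFinset v : Set V).PairwiseDisjoint
      fun w => insert w ((G.neighborFinset w).erase v) := by
  intro u hu w hw huw
  have hdisjoint := pairwiseDisjoint_erase hG v hu hw huw
  rw [mem_coe, SimpleGraph.mem_neighborFinset] at hu hw
  have hnot : ¬ G.Adj u w := fun h =>
    not_adj_of_four_le_egirth (le_trans (by norm_num) hG) hu h hw.symm
  simp only [Function.onFun, disjoint_insert_left, disjoint_insert_right, mem_insert, mem_erase,
    SimpleGraph.mem_neighborFinset]
  exact ⟨fun h => h.elim (Ne.symm huw) fun h => hnot h.2, fun h => hnot h.2.symm, hdisjoint⟩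

end Girth

section TwoBall

variable {V : Type*} [Fintype V] [DecidableEq V] {G : SimpleGraph V} [DecidableRel G.Adj] {d : ℕ}

/-- The vertices reached from `v` by walks of length one or two. -/
def twoBall (G : SimpleGraph V) [DecidableRel G.Adj] (v : V) : Finset V :=
  G.neighborFinset v ∪ (G.neighborFinset v).biUnion fun u => G.neighborFinset u

theorem neighborFinset_subset_twoBall (v : V) : G.neighborFinset v ⊆ twoBall G v :=
  subset_union_left

theorem neighborFinset_subset_twoBall_of_mem {u v : V} (hu : u ∈ G.neighborFinset v) :
    G.neighborFinset u ⊆ twoBall G v :=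
  (subset_biUnion_of_mem (fun u => G.neighborFinset u) hu).trans subset_union_right

theorem mem_twoBall_comm {u v : V} : u ∈ twoBall G v ↔ v ∈ twoBall G u := by
  simp only [twoBall, mem_union, mem_biUnion, SimpleGraph.mem_neighborFinset, G.adj_comm v]
  exact or_congr Iff.rfl (exists_congr fun w => by rw [and_comm, G.adj_comm w u])

theorem card_twoBall_le (hd : ∀ v, G.degree v ≤ d) (v : V) : #(twoBall G v) ≤ d + d * d :=
  calc #(twoBall G v) ≤ G.degree v + G.degree v * d := (card_union_le _ _).trans <|
        add_le_add_right (card_biUnion_le_card_mul _ _ d fun w _ => hd w) _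
    _ ≤ d + d * d := by gcongr <;> exact hd v

theorem card_not_disjoint_twoBall_le (hd : ∀ v, G.degree v ≤ d) (v : V) :
    #{w | ¬ Disjoint (twoBall G v) (twoBall G w)} ≤ (d + d * d) ^ 2 := by
  have hsubset : ({w | ¬ Disjoint (twoBall G v) (twoBall G w)} : Finset V) ⊆
      (twoBall G v).biUnion (twoBall G) := by
    intro w hw
    obtain ⟨x, hxv, hxw⟩ := not_disjoint_iff.mp (mem_filter.mp hw).2
    exact mem_biUnion.mpr ⟨x, hxv, mem_twoBall_comm.mp hxw⟩
  calc #{w | ¬ Disjoint (twoBall G v) (twoBall G w)}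
      ≤ #(twoBall G v) * (d + d * d) := (card_le_card hsubset).trans <|
        card_biUnion_le_card_mul _ _ _ fun w _ => card_twoBall_le hd w
    _ ≤ (d + d * d) ^ 2 := by
        rw [sq]
        gcongr
        exact card_twoBall_le hd v

end TwoBall

section Scale

variable {d k n t : ℕ}

/-- `k` is a small multiple of `√d`, and `d` is so large that `exp k` exceeds the polynomial in `d`
required by the local lemma. -/
structure IsScale (d k : ℕ) : Prop where
  pos : 0 < k
  sq_le : 2 ^ 68 * k ^ 2 ≤ d
  le_sq : d ≤ 2 ^ 70 * k ^ 2
  pow_mul_exp_le : 48 * (d : ℝ) ^ 4 * Real.exp (-k) ≤ 1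

theorem IsScale.mul_le (h : IsScale d k) : 2 ^ 68 * k ≤ d :=
  le_trans (by gcongr; exact Nat.le_self_pow two_ne_zero k) h.sq_le

theorem IsScale.add_le_mean_add_sqrt (h : IsScale d k) (ht : t ≤ d) (hn : d ≤ n + 3 * k) :
    t + 2 ^ 24 * k ≤ (t : ℝ) / d * n + √(n : ℝ) / 256 := by
  have hk : (1 : ℝ) ≤ k := mod_cast h.pos
  have hsq : 2 ^ 68 * (k : ℝ) ^ 2 ≤ d := mod_cast h.sq_le
  have hn' : (d : ℝ) ≤ n + 3 * k := mod_cast hn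
  have hd : (0 : ℝ) < d := by nlinarith
  have hroot : 2 ^ 33 * (k : ℝ) ≤ √(n : ℝ) := Real.le_sqrt_of_sq_le (by nlinarith)
  have hmean : t - (t : ℝ) / d * n ≤ 3 * k :=
    calc t - (t : ℝ) / d * n = t / d * (d - n) := by field_simp
      _ ≤ t / d * (3 * k) := by gcongr; linarith
      _ ≤ 1 * (3 * k) := by
          gcongr
          exact (div_le_one hd).mpr (mod_cast ht)
      _ = 3 * k := one_mul _
  linarith

end Scale

section Time

variable {V : Type*} {d k N : ℕ}

theorem pr_val_lt {n t : ℕ} (ht : t ≤ n) : pr (fun i : Fin n => (i : ℕ) < t) = t / n := by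
  rw [pr_eq_card_div_card, Fin.card_filter_val_lt, Fintype.card_fin, min_eq_right ht]

theorem pr_fst_val_lt [NeZero N] {t : ℕ} (ht : t ≤ d) :
    pr (fun a : Fin d × Fin N => (a.1 : ℕ) < t) = t / d :=
  (pr_fst fun i : Fin d => (i : ℕ) < t).trans (pr_val_lt ht)

theorem pr_snd_val_eq_zero [NeZero d] [NeZero N] :
    pr (fun a : Fin d × Fin N => (a.2 : ℕ) = 0) = 1 / N := by
  simp only [← Nat.lt_one_iff]
  rw [pr_snd fun i : Fin N => (i : ℕ) < 1, pr_val_lt (NeZero.one_le), Nat.cast_one]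

/-- The times in the middle half of `{0, …, d - 1}`. -/
def middleTimes (d : ℕ) : Finset ℕ := Icc (d / 4 + 1) (3 * d / 4)

theorem le_pr_fst_mem_middleTimes [NeZero N] (hd : 4 ≤ d) :
    1 / 4 ≤ pr fun a : Fin d × Fin N => (a.1 : ℕ) ∈ middleTimes d := by
  rw [pr_fst fun i : Fin d => (i : ℕ) ∈ middleTimes d, pr_eq_card_div_card, Fintype.card_fin,
    div_le_div_iff₀ (by norm_num) (by positivity)]
  have hcard : #(middleTimes d) ≤ #{i : Fin d | (i : ℕ) ∈ middleTimes d} := by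
    refine card_le_card_of_surjOn (fun i : Fin d => (i : ℕ)) fun t ht => ?_
    have := mem_Icc.mp (mem_coe.mp ht)
    exact ⟨⟨t, by omega⟩, by simpa using ht, rfl⟩
  have hmid : #(middleTimes d) = 3 * d / 4 + 1 - (d / 4 + 1) := Nat.card_Icc _ _
  exact_mod_cast (by omega : 1 * d ≤ #{i : Fin d | (i : ℕ) ∈ middleTimes d} * 4)

theorem one_fifth_le_of_mem_middleTimes {t : ℕ} (ht : t ∈ middleTimes d) : 1 / 5 ≤ (t : ℝ) / d := by
  have := mem_Icc.mp ht
  have : (d : ℝ) ≤ 4 * t := mod_cast (by omega : d ≤ 4 * t)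
  rw [div_le_div_iff₀ (by norm_num) (by norm_cast; omega)]
  linarith [(Nat.cast_nonneg t : (0 : ℝ) ≤ t)]

theorem div_le_four_fifths_of_mem_middleTimes (hd : 20 ≤ d) {t : ℕ} (ht : t ∈ middleTimes d) :
    ((t + 1 : ℕ) : ℝ) / d ≤ 4 / 5 := by
  have := mem_Icc.mp ht
  rw [div_le_div_iff₀ (by norm_cast; omega) (by norm_num)]
  exact_mod_cast (by omega : (t + 1) * 5 ≤ 4 * d)

/-- The elements of `Y` at whose time, under the schedule `T`, at least `δ` more elements of `Y`
have been removed than the time itself. Each time removes on average `#Y / d` elements of `Y`, so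
`δ` measures the deviation from the mean when `#Y` is about `d`. -/
def aheadSet (d δ : ℕ) (Y : Finset V) (T : V → ℕ) : Finset V :=
  {u ∈ Y | T u ∈ middleTimes d ∧ T u + δ ≤ #{x ∈ Y | T x < T u}}

/-- A positive proportion of the `d` times sees `Y` ahead of its mean by `δ`. -/
abbrev IsOftenAhead (d δ : ℕ) (Y : Finset V) (T : V → ℕ) : Prop :=
  d ≤ 2 ^ 15 * #(aheadSet d δ Y T)

variable {δ : ℕ} {Y Y' : Finset V} {T T' : V → ℕ}

theorem aheadSet_subset : aheadSet d δ Y T ⊆ Y := filter_subset _ _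

theorem aheadSet_mono (h : Y ⊆ Y') : aheadSet d δ Y T ⊆ aheadSet d δ Y' T := fun u hu => by
  obtain ⟨huY, hmid, hu⟩ := mem_filter.mp hu
  exact mem_filter.mpr ⟨h huY, hmid, hu.trans (card_le_card (filter_subset_filter _ h))⟩

theorem aheadSet_congr (h : ∀ x ∈ Y, T x = T' x) : aheadSet d δ Y T = aheadSet d δ Y T' := by
  refine filter_congr fun u hu => ?_
  rw [h u hu, filter_congr fun x hx => by rw [h x hx]]

/-- The time coordinate of a sample; the other coordinate is used to mark vertices. -/
def time (ω : V → Fin d × Fin N) (v : V) : ℕ := (ω v).1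

theorem isOftenAhead_time_congr {ω ω' : V → Fin d × Fin N} (h : ∀ x ∈ Y, ω x = ω' x) :
    IsOftenAhead d δ Y (time ω) ↔ IsOftenAhead d δ Y (time ω') := by
  have htime : ∀ x ∈ Y, time ω x = time ω' x := fun x hx => by rw [time, time, h x hx]
  rw [IsOftenAhead, IsOftenAhead, aheadSet_congr htime]

theorem dependsOn_card_filter {α : Type*} (Y : Finset V) (P : α → Prop) [DecidablePred P] :
    DependsOn (fun ω : V → α => #{x ∈ Y | P (ω x)}) Y := fun _ _ h =>
  congrArg card (filter_congr fun x hx => by rw [h x (mem_coe.mpr hx)])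

variable [Fintype V] [DecidableEq V] [NeZero d] [NeZero N]

theorem le_pr_mem_aheadSet (hk : IsScale d k) (hY : d ≤ #Y + 2 * k) {u : V} (hu : u ∈ Y) :
    1 / 2 ^ 13 ≤ pr fun ω : V → Fin d × Fin N => u ∈ aheadSet d (2 ^ 24 * k) Y (time ω) := by
  have hpos := hk.pos
  have hmul := hk.mul_le
  have hcard : #Y = #(Y.erase u) + 1 := (card_erase_add_one hu).symm
  have hahead (a : Fin d × Fin N) (ha : (a.1 : ℕ) ∈ middleTimes d) : 1 / 2048 ≤
      pr fun ω : V → Fin d × Fin N => a.1 + 2 ^ 24 * k ≤ #{x ∈ Y.erase u | time ω x < a.1} := by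
    have hpr := pr_fst_val_lt (N := N) a.1.isLt.le
    have hle : ((a.1 : ℕ) : ℝ) / d ≤ 4 / 5 := le_trans (by gcongr; simp)
      (div_le_four_fifths_of_mem_middleTimes (by omega) ha)
    refine (le_pr_add_sqrt_card_le_card (A := fun b : Fin d × Fin N => (b.1 : ℕ) < a.1)
      (hpr ▸ one_fifth_le_of_mem_middleTimes ha) (hpr ▸ hle) (Y := Y.erase u)
      (card_pos.mp (by omega))).trans (pr_mono fun ω h => ?_)
    rw [hpr] at h
    exact_mod_cast (hk.add_le_mean_add_sqrt a.1.isLt.le (by omega)).trans h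
  calc (1 : ℝ) / 2 ^ 13 = 1 / 2048 * (1 / 4) := by norm_num
    _ ≤ 1 / 2048 * pr fun a : Fin d × Fin N => (a.1 : ℕ) ∈ middleTimes d := by
        gcongr
        exact le_pr_fst_mem_middleTimes (by omega)
    _ ≤ pr fun ω : V → Fin d × Fin N => time ω u ∈ middleTimes d ∧
          time ω u + 2 ^ 24 * k ≤ #{x ∈ Y.erase u | time ω x < time ω u} :=
        mul_pr_le_pr_and (notMem_erase u Y)
          (fun a _ _ h => congrArg (a.1 + 2 ^ 24 * k ≤ ·)
            (dependsOn_card_filter _ (fun b : Fin d × Fin N => (b.1 : ℕ) < a.1) h))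
          hahead
    _ ≤ pr fun ω : V → Fin d × Fin N => u ∈ aheadSet d (2 ^ 24 * k) Y (time ω) :=
        pr_mono fun ω h => mem_filter.mpr ⟨hu, h.1,
          h.2.trans (card_le_card (filter_subset_filter _ (erase_subset u Y)))⟩

theorem le_pr_isOftenAhead (hk : IsScale d k) (hY : d ≤ #Y + 2 * k) :
    1 / 2 ^ 14 ≤ pr fun ω : V → Fin d × Fin N => IsOftenAhead d (2 ^ 24 * k) Y (time ω) := by
  have hmul := hk.mul_le
  have hY₀ : (0 : ℝ) < #Y := mod_cast (by have := hk.pos; omega : 0 < #Y)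
  have hd : (d : ℝ) ≤ 2 * #Y := mod_cast (by omega : d ≤ 2 * #Y)
  have hsum := sum_pr_le_add_card_mul_pr
    (fun u (ω : V → Fin d × Fin N) => u ∈ aheadSet d (2 ^ 24 * k) Y (time ω)) Y
    (m := d / 2 ^ 15) (by positivity)
  have hlow : #Y * (1 / 2 ^ 13 : ℝ) ≤ ∑ u ∈ Y,
      pr fun ω : V → Fin d × Fin N => u ∈ aheadSet d (2 ^ 24 * k) Y (time ω) := by
    rw [← nsmul_eq_mul]
    exact card_nsmul_le_sum _ _ _ fun u hu => le_pr_mem_aheadSet hk hY hu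
  have hmono : pr (fun ω : V → Fin d × Fin N =>
      (d : ℝ) / 2 ^ 15 ≤ #{u ∈ Y | u ∈ aheadSet d (2 ^ 24 * k) Y (time ω)}) ≤
      pr fun ω : V → Fin d × Fin N => IsOftenAhead d (2 ^ 24 * k) Y (time ω) := by
    refine pr_mono fun ω h => ?_
    rw [filter_mem_eq_inter, inter_eq_right.mpr aheadSet_subset,
      div_le_iff₀' (by positivity)] at h
    exact_mod_cast h
  have := hlow.trans (hsum.trans (add_le_add_right (mul_le_mul_of_nonneg_left hmono hY₀.le) _))
  nlinarith

theorem le_pr_card_le_time {t : ℕ} (hk : IsScale d k) (ht : t ∈ middleTimes d) (hYd : #Y ≤ d)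
    (hY : d ≤ #Y + 2 * k) :
    1 / 2048 ≤ pr fun ω : V → Fin d × Fin N => #{x ∈ Y | time ω x ≤ t} + 1 ≤ t := by
  have hpos := hk.pos
  have hmul := hk.mul_le
  have htd : t + 1 ≤ d := by have := mem_Icc.mp ht; omega
  have hd : (0 : ℝ) < d := mod_cast NeZero.pos d
  have hpr := pr_fst_val_lt (N := N) htd
  have hge : 1 / 5 ≤ ((t + 1 : ℕ) : ℝ) / d :=
    (one_fifth_le_of_mem_middleTimes ht).trans (by gcongr; simp)
  refine (le_pr_card_le_sub_sqrt_card (A := fun a : Fin d × Fin N => (a.1 : ℕ) < t + 1)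
    (hpr ▸ hge) (hpr ▸ div_le_four_fifths_of_mem_middleTimes (by omega) ht) (Y := Y)
    (card_pos.mp (by omega))).trans (pr_mono fun ω h => ?_)
  have hmean : ((t + 1 : ℕ) : ℝ) / d * #Y ≤ (t + 1 : ℕ) := by
    rw [div_mul_eq_mul_div, div_le_iff₀ hd]
    gcongr
  have hroot : 512 ≤ √(#Y : ℝ) :=
    Real.le_sqrt_of_sq_le (mod_cast (by omega : 512 ^ 2 ≤ #Y))
  rw [hpr] at h
  simp only [Nat.lt_succ_iff] at h
  have : (#{x ∈ Y | time ω x ≤ t} : ℝ) ≤ (t + 1 : ℕ) - 2 := by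
    refine h.trans ?_
    linarith
  push_cast at this
  exact_mod_cast (by linarith : (#{x ∈ Y | time ω x ≤ t} : ℝ) + 1 ≤ t)

end Time

section Schedule

variable {V : Type*} [Fintype V] [DecidableEq V] {G : SimpleGraph V} [DecidableRel G.Adj]
  {d k N δ : ℕ} {T T' : V → ℕ}

/-- All degrees lie between `d - k` and `d`. -/
structure IsNearRegular (G : SimpleGraph V) [DecidableRel G.Adj] (d k : ℕ) : Prop where
  degree_le : ∀ v, G.degree v ≤ d
  le_degree_add : ∀ v, d ≤ G.degree v + k

theorem IsNearRegular.le_card_erase_add (hr : IsNearRegular G d k) (hk : 0 < k) (v w : V) :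
    d ≤ #((G.neighborFinset v).erase w) + 2 * k := by
  have := hr.le_degree_add v
  have := pred_card_le_card_erase (s := G.neighborFinset v) (a := w)
  rw [G.card_neighborFinset_eq_degree] at this
  omega

theorem IsNearRegular.card_erase_le (hr : IsNearRegular G d k) (v w : V) :
    #((G.neighborFinset v).erase w) ≤ d :=
  (card_le_card (erase_subset _ _)).trans (hr.degree_le v)

/-- The neighbours `u` of `w` whose removal can save `w`: when `u` is removed, `w` has lost more
neighbours than the time by `δ`, whereas `u` has lost at most as many as the time. -/
def savers (G : SimpleGraph V) [DecidableRel G.Adj] (d δ : ℕ) (T : V → ℕ) (w : V) : Finset V :=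
  {u ∈ aheadSet d δ (G.neighborFinset w) T | #{x ∈ G.neighborFinset u | T x ≤ T u} ≤ T u}

theorem savers_congr {w : V} (h : ∀ x ∈ twoBall G w, T x = T' x) :
    savers G d δ T w = savers G d δ T' w := by
  unfold savers
  rw [aheadSet_congr fun x hx => h x (neighborFinset_subset_twoBall w hx)]
  refine filter_congr fun u hu => ?_
  have huw := aheadSet_subset hu
  rw [h u (neighborFinset_subset_twoBall w huw),
    filter_congr fun x hx => by rw [h x (neighborFinset_subset_twoBall_of_mem huw hx)]]

theorem mem_savers_piecewise (hG : 4 ≤ G.egirth) {u v : V} {ω ω' : V → Fin d × Fin N}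
    (hu : u ∈ aheadSet d δ (G.neighborFinset v) (time ω))
    (hcard : #{x ∈ (G.neighborFinset u).erase v | time ω' x ≤ time ω u} + 1 ≤ time ω u) :
    u ∈ savers G d δ (time ((G.neighborFinset v).piecewise ω ω')) v := by
  have hon (x : V) (hx : x ∈ G.neighborFinset v) :
      time ((G.neighborFinset v).piecewise ω ω') x = time ω x := by
    rw [time, piecewise_eq_of_mem _ _ _ hx, time]
  have huv := aheadSet_subset hu
  refine mem_filter.mpr ⟨by rwa [aheadSet_congr hon], ?_⟩
  rw [hon u huv]
  refine le_trans (card_le_card fun x hx => ?_) ((card_insert_le v _).trans hcard)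
  obtain ⟨hxu, hx⟩ := mem_filter.mp hx
  have hxv : x ∉ G.neighborFinset v :=
    disjoint_left.mp (disjoint_neighborFinset hG ((G.mem_neighborFinset v u).mp huv).symm) hxu
  rw [time, piecewise_eq_of_notMem _ _ _ hxv] at hx
  by_cases hxv' : x = v
  · exact hxv' ▸ mem_insert_self _ _
  · exact mem_insert_of_mem (mem_filter.mpr ⟨mem_erase.mpr ⟨hxv', hxu⟩, hx⟩)

/-- The vertex `w` is marked, and its neighbourhood is ahead often enough for `w` to be saved many
times. Reserved vertices are removed after all others. -/
def IsReserved (G : SimpleGraph V) [DecidableRel G.Adj] (k : ℕ) (ω : V → Fin d × Fin N)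
    (w : V) : Prop :=
  ((ω w).2 : ℕ) = 0 ∧ IsOftenAhead d (2 ^ 24 * k) (G.neighborFinset w) (time ω)

instance (ω : V → Fin d × Fin N) : DecidablePred (IsReserved G k ω) :=
  fun _ => inferInstanceAs (Decidable (_ ∧ _))

/-- The events to be avoided at `v`: too many marked neighbours, too few reserved neighbours, or
too few savers of `v` although its neighbourhood is often ahead. -/
def IsBad (G : SimpleGraph V) [DecidableRel G.Adj] (k : ℕ) (ω : V → Fin d × Fin N) (v : V) :
    Prop :=
  2 ^ 22 * k < #{w ∈ G.neighborFinset v | ((ω w).2 : ℕ) = 0} ∨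
    #{w ∈ G.neighborFinset v | IsReserved G k ω w} < k ∨
    IsOftenAhead d (2 ^ 24 * k) (G.neighborFinset v) (time ω) ∧
      2 ^ 28 * #(savers G d (2 ^ 24 * k) (time ω) v) < d

theorem dependsOn_isBad (v : V) :
    DependsOn (fun ω : V → Fin d × Fin N => IsBad G k ω v) (twoBall G v) := by
  intro ω ω' h
  have htime (x : V) (hx : x ∈ twoBall G v) : time ω x = time ω' x := by
    rw [time, time, h x hx]
  have hreserved (w : V) (hw : w ∈ G.neighborFinset v) :
      IsReserved G k ω w ↔ IsReserved G k ω' w := by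
    rw [IsReserved, IsReserved, h w (neighborFinset_subset_twoBall v hw), isOftenAhead_time_congr
      fun x hx => h x (neighborFinset_subset_twoBall_of_mem hw hx)]
  have hnear : ∀ x ∈ G.neighborFinset v, ω x = ω' x := fun x hx =>
    h x (neighborFinset_subset_twoBall v hx)
  have hmarked : #{w ∈ G.neighborFinset v | ((ω w).2 : ℕ) = 0} =
      #{w ∈ G.neighborFinset v | ((ω' w).2 : ℕ) = 0} :=
    dependsOn_card_filter _ (fun a : Fin d × Fin N => (a.2 : ℕ) = 0) hnear
  simp only [IsBad]
  rw [hmarked, filter_congr hreserved, savers_congr htime, isOftenAhead_time_congr hnear]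

variable [NeZero d] [NeZero N]

theorem pr_many_marked_le (hk : IsScale d k) (hr : IsNearRegular G d k) (hN : N = 2 ^ 50 * k)
    (v : V) :
    pr (fun ω : V → Fin d × Fin N => 2 ^ 22 * k < #{w ∈ G.neighborFinset v | ((ω w).2 : ℕ) = 0}) ≤
      Real.exp (-k) := by
  have hk₀ : (0 : ℝ) < k := mod_cast hk.pos
  have hdeg : (G.degree v : ℝ) ≤ 2 ^ 70 * (k : ℝ) ^ 2 :=
    mod_cast (hr.degree_le v).trans hk.le_sq
  have hmean : 4 * ∑ w ∈ G.neighborFinset v, pr (fun ω : V → Fin d × Fin N => ((ω w).2 : ℕ) = 0) ≤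
      2 ^ 22 * k := by
    simp only [pr_eval _ fun a : Fin d × Fin N => (a.2 : ℕ) = 0, pr_snd_val_eq_zero, sum_const,
      G.card_neighborFinset_eq_degree, nsmul_eq_mul, hN]
    push_cast
    rw [mul_one_div, ← mul_div_assoc, div_le_iff₀ (by positivity)]
    nlinarith
  calc pr (fun ω : V → Fin d × Fin N =>
          2 ^ 22 * k < #{w ∈ G.neighborFinset v | ((ω w).2 : ℕ) = 0})
      ≤ pr (fun ω : V → Fin d × Fin N =>
          2 ^ 22 * (k : ℝ) < #{w ∈ G.neighborFinset v | ((ω w).2 : ℕ) = 0}) :=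
        pr_mono fun ω h => mod_cast h
    _ ≤ Real.exp (-(2 ^ 22 * k / 2)) :=
        pr_lt_card_le_exp (D := fun w => {w}) (fun w _ ω ω' h => by simp only [h w (by simp)])
          (fun x _ y _ hxy => by simpa using hxy) hmean
    _ ≤ Real.exp (-k) := Real.exp_le_exp.mpr (by linarith)

theorem le_pr_marked_and_isOftenAhead (hk : IsScale d k) {Y : Finset V} (hY : d ≤ #Y + 2 * k)
    {w : V} (hw : w ∉ Y) :
    1 / (2 ^ 14 * N) ≤ pr fun ω : V → Fin d × Fin N =>
      ((ω w).2 : ℕ) = 0 ∧ IsOftenAhead d (2 ^ 24 * k) Y (time ω) := by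
  rw [pr_and_of_dependsOn (S := {w}) (T := Y) (fun ω ω' h => by simp only [h w (by simp)])
    (fun _ _ h => propext (isOftenAhead_time_congr h)) (by simpa using hw),
    pr_eval w fun a : Fin d × Fin N => (a.2 : ℕ) = 0, pr_snd_val_eq_zero]
  calc (1 : ℝ) / (2 ^ 14 * N) = 1 / N * (1 / 2 ^ 14) := by rw [one_div_mul_one_div, mul_comm]
    _ ≤ _ := by
        gcongr
        exact le_pr_isOftenAhead hk hY

theorem pr_few_reserved_le (hk : IsScale d k) (hr : IsNearRegular G d k) (hG : 5 ≤ G.egirth)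
    (hN : N = 2 ^ 50 * k) (v : V) :
    pr (fun ω : V → Fin d × Fin N => #{w ∈ G.neighborFinset v | IsReserved G k ω w} < k) ≤
      Real.exp (-k) := by
  have hk₀ : (0 : ℝ) < k := mod_cast hk.pos
  have hdeg : 2 ^ 67 * (k : ℝ) ^ 2 ≤ G.degree v := by
    have := hr.le_degree_add v
    have := hk.sq_le
    have := hk.mul_le
    exact_mod_cast (by omega : 2 ^ 67 * k ^ 2 ≤ G.degree v)
  let A (w : V) (ω : V → Fin d × Fin N) : Prop :=
    ((ω w).2 : ℕ) = 0 ∧ IsOftenAhead d (2 ^ 24 * k) ((G.neighborFinset w).erase v) (time ω)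
  have hA (w : V) : DependsOn (A w) (insert w ((G.neighborFinset w).erase v) : Finset V) := by
    intro ω ω' h
    simp only [A]
    rw [h w (by simp), isOftenAhead_time_congr fun x hx => h x (mem_insert_of_mem hx)]
  have hmean : 4 * (k : ℝ) ≤ ∑ w ∈ G.neighborFinset v, pr (A w) := by
    have hprob (w : V) : 1 / (2 ^ 64 * (k : ℝ)) ≤ pr (A w) := by
      refine le_of_eq_of_le ?_ (le_pr_marked_and_isOftenAhead hk
        (hr.le_card_erase_add hk.pos w v) (by simp))
      rw [hN]
      push_cast
      ring
    calc 4 * (k : ℝ) ≤ (2 ^ 67 * k ^ 2) * (1 / (2 ^ 64 * k)) := by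
          rw [mul_one_div, le_div_iff₀ (by positivity)]
          nlinarith
      _ ≤ G.degree v * (1 / (2 ^ 64 * k)) := by gcongr
      _ ≤ ∑ w ∈ G.neighborFinset v, pr (A w) := by
          rw [← G.card_neighborFinset_eq_degree, ← nsmul_eq_mul]
          exact card_nsmul_le_sum _ _ _ fun w _ => hprob w
  have htail := pr_card_lt_le_exp (fun w _ => hA w) (pairwiseDisjoint_insert_erase hG v)
    (by positivity) hmean
  rw [mul_div_cancel_left₀ _ (by norm_num : (4 : ℝ) ≠ 0)] at htail
  refine (pr_mono fun ω hω => ?_).trans htail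
  refine Nat.cast_lt.mpr (lt_of_le_of_lt (card_le_card fun w hw => ?_) hω)
  obtain ⟨hwv, hmarked, hahead⟩ := mem_filter.mp hw
  exact mem_filter.mpr ⟨hwv, hmarked, hahead.trans
    (mul_le_mul_right (card_le_card (aheadSet_mono (erase_subset _ _))) _)⟩

theorem pr_few_on_time_le (hk : IsScale d k) (hr : IsNearRegular G d k) (hG : 5 ≤ G.egirth)
    {v : V} {U : Finset V} {t : V → ℕ} (hUv : U ⊆ G.neighborFinset v)
    (ht : ∀ u ∈ U, t u ∈ middleTimes d) (hU : d ≤ 2 ^ 15 * #U) :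
    pr (fun ω : V → Fin d × Fin N =>
      2 ^ 28 * #{u ∈ U | #{x ∈ (G.neighborFinset u).erase v | time ω x ≤ t u} + 1 ≤ t u} < d) ≤
      Real.exp (-k) := by
  let A (u : V) (ω : V → Fin d × Fin N) : Prop :=
    #{x ∈ (G.neighborFinset u).erase v | time ω x ≤ t u} + 1 ≤ t u
  have hA (u : V) : DependsOn (A u) ((G.neighborFinset u).erase v) := fun _ _ h =>
    congrArg (· + 1 ≤ t u) (dependsOn_card_filter _ (fun a : Fin d × Fin N => (a.1 : ℕ) ≤ t u) h)
  have hmean : (d : ℝ) / 2 ^ 26 ≤ ∑ u ∈ U, pr (A u) :=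
    calc (d : ℝ) / 2 ^ 26 ≤ #U * (1 / 2048) := by
          have : (d : ℝ) ≤ 2 ^ 15 * #U := mod_cast hU
          linarith
      _ ≤ ∑ u ∈ U, pr (A u) := by
          rw [← nsmul_eq_mul]
          exact card_nsmul_le_sum _ _ _ fun u hu =>
            le_pr_card_le_time hk (ht u hu) (hr.card_erase_le u v)
              (hr.le_card_erase_add hk.pos u v)
  have hkd : (k : ℝ) ≤ d / 2 ^ 26 / 4 := by
    have : 2 ^ 68 * (k : ℝ) ≤ d := mod_cast hk.mul_le
    linarith
  refine (pr_mono fun ω (hω : 2 ^ 28 * #{u ∈ U | A u ω} < d) => ?_).trans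
    ((pr_card_lt_le_exp (I := U) (fun u _ => hA u)
      ((pairwiseDisjoint_erase hG v).subset (coe_subset.mpr hUv)) (by positivity) hmean).trans
      (Real.exp_le_exp.mpr (neg_le_neg hkd)))
  have : (2 : ℝ) ^ 28 * #{u ∈ U | A u ω} < d := mod_cast hω
  linarith

theorem pr_few_savers_le (hk : IsScale d k) (hr : IsNearRegular G d k) (hG : 5 ≤ G.egirth)
    (v : V) :
    pr (fun ω : V → Fin d × Fin N =>
      IsOftenAhead d (2 ^ 24 * k) (G.neighborFinset v) (time ω) ∧
        2 ^ 28 * #(savers G d (2 ^ 24 * k) (time ω) v) < d) ≤ Real.exp (-k) := by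
  -- With the times in the neighbourhood of `v` fixed, the counts at its members are independent.
  refine pr_le_of_forall_pr_piecewise_le (G.neighborFinset v) fun ω => ?_
  set U := aheadSet d (2 ^ 24 * k) (G.neighborFinset v) (time ω)
  have hahead (ω' : V → Fin d × Fin N) :
      aheadSet d (2 ^ 24 * k) (G.neighborFinset v)
        (time ((G.neighborFinset v).piecewise ω ω')) = U :=
    aheadSet_congr fun x hx => by rw [time, piecewise_eq_of_mem _ _ _ hx, time]
  by_cases hU : d ≤ 2 ^ 15 * #U
  · refine (pr_mono fun ω' hω' => ?_).trans (pr_few_on_time_le (t := time ω) hk hr hG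
      aheadSet_subset (fun u hu => (mem_filter.mp hu).2.1) hU)
    exact lt_of_le_of_lt (mul_le_mul_right (card_le_card fun u hu => mem_savers_piecewise
      (le_trans (by norm_num) hG) (mem_filter.mp hu).1 (mem_filter.mp hu).2) _) hω'.2
  · simp only [IsOftenAhead, hahead, hU, false_and, pr_false]
    positivity

theorem pr_isBad_le (hk : IsScale d k) (hr : IsNearRegular G d k) (hG : 5 ≤ G.egirth)
    (hN : N = 2 ^ 50 * k) (v : V) :
    pr (fun ω : V → Fin d × Fin N => IsBad G k ω v) ≤ 3 * Real.exp (-k) := by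
  have hor := (pr_or_le _ _).trans <| add_le_add (pr_many_marked_le hk hr hN v) <|
    (pr_or_le _ _).trans <|
      add_le_add (pr_few_reserved_le hk hr hG hN v) (pr_few_savers_le (N := N) hk hr hG v)
  exact hor.trans (by linarith)

end Schedule

section ExistsSchedule

variable {V : Type*} [Fintype V] [DecidableEq V] {G : SimpleGraph V} [DecidableRel G.Adj]
  {d k : ℕ}

/-- A set `B` of reserved vertices and removal times `T` for the other vertices, such that every
vertex has at least `k` and at most `O(k)` reserved neighbours and every reserved vertex has
`Ω(d)` savers. -/
structure IsSchedule (G : SimpleGraph V) [DecidableRel G.Adj] (d k : ℕ) (T : V → ℕ)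
    (B : Finset V) : Prop where
  time_lt : ∀ v, T v < d
  le_card_reserved : ∀ v, k ≤ #{w ∈ G.neighborFinset v | w ∈ B}
  card_reserved_le : ∀ v, #{w ∈ G.neighborFinset v | w ∈ B} ≤ 2 ^ 22 * k
  le_card_savers : ∀ w ∈ B, d ≤ 2 ^ 28 * #(savers G d (2 ^ 24 * k) T w)

theorem IsSchedule.of_not_isBad {N : ℕ} {ω : V → Fin d × Fin N} (h : ∀ v, ¬ IsBad G k ω v) :
    IsSchedule G d k (time ω) {w | IsReserved G k ω w} := by
  simp only [IsBad, not_or, not_and, not_lt] at h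
  refine ⟨fun v => (ω v).1.isLt, fun v => ?_, fun v => ?_, fun w hw => ?_⟩
  · simpa only [mem_filter_univ] using (h v).2.1
  · simp only [mem_filter_univ]
    exact (card_le_card (monotone_filter_right _ fun w _ hw => hw.1)).trans (h v).1
  · exact (h w).2.2 (mem_filter.mp hw).2.2

theorem exists_isSchedule (hk : IsScale d k) (hr : IsNearRegular G d k) (hG : 5 ≤ G.egirth) :
    ∃ T B, IsSchedule G d k T B := by
  have hk₀ := hk.pos
  have hd := hk.mul_le
  have : NeZero d := ⟨by omega⟩
  have : NeZero (2 ^ 50 * k) := ⟨by omega⟩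
  have hd₁ : (1 : ℝ) ≤ d := mod_cast NeZero.one_le
  obtain ⟨ω, hω⟩ := exists_forall_not_of_dependsOn (α := Fin d × Fin (2 ^ 50 * k))
    (fun v : V => dependsOn_isBad (G := G) (k := k) v) (pr_isBad_le hk hr hG rfl)
    (card_not_disjoint_twoBall_le hr.degree_le) (Nat.one_le_pow _ _ (by omega)) <|
    calc 4 * (3 * Real.exp (-k)) * ((d + d * d) ^ 2 : ℕ)
        = 12 * (d + d * d : ℝ) ^ 2 * Real.exp (-k) := by push_cast; ring
      _ ≤ 12 * (d * d + d * d : ℝ) ^ 2 * Real.exp (-k) := by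
          gcongr
          exact le_mul_of_one_le_left (by positivity) hd₁
      _ = 48 * (d : ℝ) ^ 4 * Real.exp (-k) := by ring
      _ ≤ 1 := hk.pow_mul_exp_le
  exact ⟨_, _, .of_not_isBad hω⟩

end ExistsSchedule

section Assignment

variable {α β : Type*} [DecidableEq α] {B : Finset β} {U : β → Finset α} {k M : ℕ}

theorem card_le_card_biUnion_of_mul_le_card (hM : 0 < M) (hU : ∀ w ∈ B, k * M ≤ #(U w))
    (hB : ∀ u, #{w ∈ B | u ∈ U w} ≤ M) (s : Finset (B × Fin k)) :
    #s ≤ #(s.biUnion fun p => U p.1) := by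
  classical
  set W : Finset β := s.image fun p => p.1
  have hWB : W ⊆ B := image_subset_iff.mpr fun p _ => p.1.2
  have hs : #s ≤ #W * k := by
    have hsub : s.map ((Function.Embedding.subtype _).prodMap (.refl _)) ⊆ W ×ˢ univ := by
      intro p hp
      obtain ⟨q, hq, rfl⟩ := mem_map.mp hp
      exact mem_product.mpr ⟨mem_image_of_mem _ hq, mem_univ _⟩
    simpa using card_le_card hsub
  have hdouble : #W * (k * M) ≤ #(s.biUnion fun p => U p.1) * M := by
    refine card_mul_le_card_mul (fun w u => u ∈ U w) (fun w hw => ?_) fun u _ =>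
      (card_le_card (filter_subset_filter _ hWB)).trans (hB u)
    refine (hU w (hWB hw)).trans (card_le_card fun u hu => ?_)
    obtain ⟨p, hp, rfl⟩ := mem_image.mp hw
    exact (mem_bipartiteAbove _).mpr ⟨mem_biUnion.mpr ⟨p, hp, hu⟩, hu⟩
  rw [← mul_assoc] at hdouble
  exact hs.trans (Nat.le_of_mul_le_mul_right hdouble hM)

theorem exists_option_assignment [Fintype α] [DecidableEq β] (hM : 0 < M)
    (hU : ∀ w ∈ B, k * M ≤ #(U w)) (hB : ∀ u, #{w ∈ B | u ∈ U w} ≤ M) :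
    ∃ σ : α → Option β, (∀ u w, σ u = some w → w ∈ B ∧ u ∈ U w) ∧
      ∀ w ∈ B, #{u | σ u = some w} = k := by
  obtain ⟨f, hf, hfU⟩ := (all_card_le_biUnion_card_iff_exists_injective
    fun p : B × Fin k => U p.1).mp (card_le_card_biUnion_of_mul_le_card hM hU hB)
  have hσ (u : α) (w : β) : (Function.partialInv f u).map (fun p => (p.1 : β)) = some w ↔
      ∃ p, f p = u ∧ (p.1 : β) = w := by
    simp only [Option.map_eq_some_iff, (hf.isPartialInv _ _)]
  refine ⟨fun u => (Function.partialInv f u).map fun p => p.1, fun u w huw => ?_, fun w hw => ?_⟩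
  · obtain ⟨p, rfl, rfl⟩ := (hσ u w).mp huw
    exact ⟨p.1.2, hfU p⟩
  · have himage : ({u | (Function.partialInv f u).map (fun p => (p.1 : β)) = some w} : Finset α) =
        univ.image fun i : Fin k => f (⟨w, hw⟩, i) := by
      ext u
      rw [mem_filter_univ, hσ]
      constructor
      · rintro ⟨⟨_, i⟩, rfl, rfl⟩
        exact mem_image_of_mem _ (mem_univ i)
      · intro hu
        obtain ⟨i, -, rfl⟩ := mem_image.mp hu
        exact ⟨_, rfl, rfl⟩
    rw [himage, card_image_of_injective _ fun i j hij => by simpa using hf hij, card_fin]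

end Assignment

section Saving

variable {V : Type*} {G : SimpleGraph V} {d k : ℕ} {T : V → ℕ} {B : Finset V} {σ : V → Option V}

theorem lost_add_card_le_degree [Fintype V] [DecidableRel G.Adj] {R C : Finset V} {v : V}
    (hC : C ⊆ G.neighborFinset v) (hlost : ∀ x ∈ C, x ∈ R → σ x = some v) :
    lost G σ R v + #C ≤ G.degree v := by
  classical
  rw [← G.card_neighborFinset_eq_degree, ← card_sdiff_add_card_eq_card hC]
  refine Nat.add_le_add_right (lost_le_card fun x hxR hadj hxv => ?_) _
  exact mem_sdiff.mpr ⟨(G.mem_neighborFinset v x).mpr hadj.symm, fun hxC => hxv (hlost x hxC hxR)⟩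

variable [DecidableEq V]

/-- The rank in the removal order: `T` outside the reserved set `B`, and the value `d`, which
exceeds all times, on `B`. -/
def removalTime (d : ℕ) (T : V → ℕ) (B : Finset V) (x : V) : ℕ :=
  if x ∈ B then d else T x

theorem notMem_and_le_of_removalTime_le (hT : ∀ v, T v < d) {x u : V} (hu : u ∉ B)
    (h : removalTime d T B x ≤ removalTime d T B u) : x ∉ B ∧ T x ≤ T u := by
  have := hT u
  simp only [removalTime, if_neg hu] at h
  split_ifs at h with hx
  · omega
  · exact ⟨hx, h⟩

variable [Fintype V] [DecidableRel G.Adj]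

theorem mul_le_card_savers_sdiff (hk : IsScale d k) (h : IsSchedule G d k T B) {w : V}
    (hw : w ∈ B) : k * (2 ^ 22 * k) ≤ #(savers G d (2 ^ 24 * k) T w \ B) := by
  have hsavers := h.le_card_savers w hw
  have hreserved : #(savers G d (2 ^ 24 * k) T w ∩ B) ≤ 2 ^ 22 * k :=
    (card_le_card fun u hu => mem_filter.mpr
      ⟨aheadSet_subset (mem_filter.mp (mem_inter.mp hu).1).1, (mem_inter.mp hu).2⟩).trans
      (h.card_reserved_le w)
  have hsplit := card_sdiff_add_card_inter (savers G d (2 ^ 24 * k) T w) B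
  have hsq := hk.sq_le
  have := Nat.le_self_pow two_ne_zero k
  rw [mul_left_comm, ← sq]
  omega

/-- `σ` assigns to every reserved vertex `w ∈ B` exactly `k` of its savers outside `B`. They are to
be removed by `DelSave(·, w)`, and the vertices assigned to no `w` by `Delete`. -/
structure IsSaverAssignment (G : SimpleGraph V) [DecidableRel G.Adj] (d k : ℕ) (T : V → ℕ)
    (B : Finset V) (σ : V → Option V) : Prop where
  mem : ∀ u w, σ u = some w → w ∈ B ∧ u ∈ savers G d (2 ^ 24 * k) T w \ B
  card_eq : ∀ w ∈ B, #{u | σ u = some w} = k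

theorem IsSaverAssignment.mem_neighborFinset (hσ : IsSaverAssignment G d k T B σ) {u w : V}
    (huw : σ u = some w) : u ∈ G.neighborFinset w :=
  aheadSet_subset (mem_filter.mp (mem_sdiff.mp (hσ.mem u w huw).2).1).1

theorem exists_isSaverAssignment (hk : IsScale d k) (h : IsSchedule G d k T B) :
    ∃ σ, IsSaverAssignment G d k T B σ := by
  obtain ⟨σ, hmem, hcard⟩ := exists_option_assignment
    (U := fun w => savers G d (2 ^ 24 * k) T w \ B)
    (mul_pos (by norm_num) hk.pos) (fun w hw => mul_le_card_savers_sdiff hk h hw) fun u =>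
    (card_le_card fun w hw => by
      obtain ⟨hwB, hu⟩ := mem_filter.mp hw
      have huw := aheadSet_subset (mem_filter.mp (mem_sdiff.mp hu).1).1
      rw [G.mem_neighborFinset] at huw
      exact mem_filter.mpr ⟨(G.mem_neighborFinset u w).mpr huw.symm, hwB⟩).trans
        (h.card_reserved_le u)
  exact ⟨σ, hmem, hcard⟩

theorem lost_add_le_degree (h : IsSchedule G d k T B) (hσ : IsSaverAssignment G d k T B σ)
    (v : V) :
    lost G σ {x | removalTime d T B x ≤ removalTime d T B v} v + k ≤ G.degree v := by
  by_cases hv : v ∈ B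
  · rw [← hσ.card_eq v hv]
    exact lost_add_card_le_degree
      (fun x hx => hσ.mem_neighborFinset (mem_filter.mp hx).2) fun x hx _ => (mem_filter.mp hx).2
  · refine le_trans (Nat.add_le_add_left (h.le_card_reserved v) _)
      (lost_add_card_le_degree (filter_subset _ _) fun x hx hxv => ?_)
    exact absurd (mem_filter.mp hx).2
      (notMem_and_le_of_removalTime_le h.time_lt hv (mem_filter.mp hxv).2).1

theorem lost_saver_le (h : IsSchedule G d k T B) (hσ : IsSaverAssignment G d k T B σ) {u w : V}
    (huw : σ u = some w) :
    lost G σ {x | removalTime d T B x ≤ removalTime d T B u} u ≤ T u := by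
  obtain ⟨husavers, huB⟩ := mem_sdiff.mp (hσ.mem u w huw).2
  refine (lost_le_card fun x hxu hadj _ => ?_).trans (mem_filter.mp husavers).2
  exact mem_filter.mpr ⟨(G.mem_neighborFinset u x).mpr hadj.symm,
    (notMem_and_le_of_removalTime_le h.time_lt huB (mem_filter.mp hxu).2).2⟩

theorem lt_lost_saved (hk : IsScale d k) (h : IsSchedule G d k T B)
    (hσ : IsSaverAssignment G d k T B σ) {u w : V} (huw : σ u = some w) :
    T u < lost G σ {x | removalTime d T B x < removalTime d T B u} w := by
  obtain ⟨hw, hu⟩ := hσ.mem u w huw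
  obtain ⟨husavers, huB⟩ := mem_sdiff.mp hu
  have hahead : T u + 2 ^ 24 * k ≤ #{x ∈ G.neighborFinset w | T x < T u} :=
    (mem_filter.mp (mem_filter.mp husavers).1).2.2
  set C := {x ∈ G.neighborFinset w | T x < T u}
  set C' := {x ∈ G.neighborFinset w | x ∈ B} ∪ ({x | σ x = some w} : Finset V)
  have hlost : #(C \ C') ≤ lost G σ {x | removalTime d T B x < removalTime d T B u} w := by
    refine card_le_lost fun x hx => ?_
    simp only [C, C', mem_sdiff, mem_union, mem_filter, mem_univ, true_and, not_or,
      not_and] at hx ⊢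
    obtain ⟨⟨hxw, hxu⟩, hxB, hxσ⟩ := hx
    refine ⟨?_, ((G.mem_neighborFinset w x).mp hxw).symm, hxσ⟩
    rwa [removalTime, if_neg (hxB hxw), removalTime, if_neg huB]
  have hC' : #C' ≤ 2 ^ 22 * k + k := (card_union_le _ _).trans
    (add_le_add (h.card_reserved_le w) (hσ.card_eq w hw).le)
  have := le_card_sdiff C' C
  have := hk.pos
  omega

theorem IsSchedule.isWeaklyDegenerate (hk : IsScale d k) (hdeg : ∀ v, G.degree v ≤ d)
    (h : IsSchedule G d k T B) : IsWeaklyDegenerate G fun _ => d - k := by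
  obtain ⟨σ, hσ⟩ := exists_isSaverAssignment hk h
  refine isWeaklyDegenerate_of_rank (removalTime d T B) σ (fun v => ?_) fun u w huw =>
    ⟨?_, ?_, (lost_saver_le h hσ huw).trans_lt (lt_lost_saved hk h hσ huw)⟩
  · exact Nat.le_sub_of_add_le ((lost_add_le_degree h hσ v).trans (hdeg v))
  · exact ((G.mem_neighborFinset w u).mp (hσ.mem_neighborFinset huw)).symm
  · obtain ⟨hw, hu⟩ := hσ.mem u w huw
    simpa [removalTime, hw, (mem_sdiff.mp hu).2] using h.time_lt u

end Saving

section MaxDegree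

variable {V : Type*} {G : SimpleGraph V} {d k : ℕ}

theorem IsNearRegular.isWeaklyDegenerate [Fintype V] [DecidableRel G.Adj] (hk : IsScale d k)
    (hr : IsNearRegular G d k) (hG : 5 ≤ G.egirth) : IsWeaklyDegenerate G fun _ => d - k := by
  classical
  obtain ⟨T, B, h⟩ := exists_isSchedule hk hr hG
  exact h.isWeaklyDegenerate hk hr.degree_le

theorem isWeaklyDegenerate_of_degree_le [Fintype V] [DecidableRel G.Adj] (hk : IsScale d k)
    (hdeg : ∀ v, G.degree v ≤ d) (hG : 5 ≤ G.egirth) : IsWeaklyDegenerate G fun _ => d - k := by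
  classical
  refine isWeaklyDegenerate_of_forall_induce fun S hS => ?_
  refine IsNearRegular.isWeaklyDegenerate hk ⟨fun v => ?_, fun v => ?_⟩
    (hG.trans (SimpleGraph.Embedding.induce S).isContained.egirth_le)
  · exact ((SimpleGraph.Embedding.induce S).toCopy.degree_le v).trans (hdeg v)
  · have := hS v
    rw [Set.ncard_eq_toFinset_card', ← SimpleGraph.neighborFinset_def,
      SimpleGraph.card_neighborFinset_eq_degree] at this
    omega

end MaxDegree

theorem eventually_exists_isScale :
    ∀ᶠ d : ℕ in Filter.atTop, ∃ k, IsScale d k ∧ √(d : ℝ) ≤ 2 ^ 35 * k := by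
  have hlim := (Real.tendsto_pow_mul_exp_neg_atTop_nhds_zero 8).comp tendsto_natCast_atTop_atTop
    |>.const_mul (48 * (2 ^ 70) ^ 4 : ℝ)
  rw [mul_zero] at hlim
  obtain ⟨k₀, hk₀⟩ := Filter.eventually_atTop.mp (hlim.eventually_le_const one_pos)
  filter_upwards [Filter.eventually_ge_atTop ((2 ^ 34 * (k₀ + 1)) ^ 2)] with d hd
  set k := Nat.sqrt d / 2 ^ 34
  have hk : k₀ + 1 ≤ k := (Nat.le_div_iff_mul_le (by norm_num)).mpr <|
    Nat.le_sqrt'.mpr (by rwa [mul_comm])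
  have hlow : 2 ^ 34 * k ≤ Nat.sqrt d := Nat.mul_div_le _ _
  have hup : Nat.sqrt d + 1 ≤ 2 ^ 35 * k := by omega
  have hsq : d ≤ (2 ^ 35 * k) ^ 2 :=
    (Nat.lt_succ_sqrt' d).le.trans (Nat.pow_le_pow_left hup 2)
  refine ⟨k, ⟨by omega, ?_, by linarith, ?_⟩, ?_⟩
  · calc 2 ^ 68 * k ^ 2 = (2 ^ 34 * k) ^ 2 := by ring
      _ ≤ Nat.sqrt d ^ 2 := Nat.pow_le_pow_left hlow 2
      _ ≤ d := Nat.sqrt_le' d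
  · have hsq' : (d : ℝ) ≤ 2 ^ 70 * k ^ 2 := mod_cast (by linarith : d ≤ 2 ^ 70 * k ^ 2)
    calc 48 * (d : ℝ) ^ 4 * Real.exp (-k) ≤ 48 * (2 ^ 70 * k ^ 2) ^ 4 * Real.exp (-k) := by gcongr
      _ = 48 * (2 ^ 70) ^ 4 * (k ^ 8 * Real.exp (-k)) := by ring
      _ ≤ 1 := hk₀ k (by omega)
  · exact Real.sqrt_le_left (by positivity) |>.mpr (mod_cast hsq)

end WeakDegeneracy

theorem theorem1p10 :
    ∃ c : ℝ, 0 < c ∧ ∃ d₀ : ℕ,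
      ∀ (V : Type*) [Fintype V] (G : SimpleGraph V) [DecidableRel G.Adj] (d : ℕ),
        d₀ ≤ d → G.maxDegree = d → 5 ≤ G.egirth →
          (WeakDegeneracy.weakDegeneracy G : ℝ) ≤ (d : ℝ) - c * Real.sqrt (d : ℝ) := by
  obtain ⟨d₀, hd₀⟩ := Filter.eventually_atTop.mp WeakDegeneracy.eventually_exists_isScale
  refine ⟨1 / 2 ^ 35, by positivity, d₀, fun V _ G _ d hd hmax hgirth => ?_⟩
  obtain ⟨k, hk, hsqrt⟩ := hd₀ d hd
  have hdegree : ∀ v, G.degree v ≤ d := fun v => hmax ▸ G.degree_le_maxDegree v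
  have hwd : WeakDegeneracy.weakDegeneracy G ≤ d - k :=
    Nat.sInf_le (WeakDegeneracy.isWeaklyDegenerate_of_degree_le hk hdegree hgirth)
  have hkd : k ≤ d := (Nat.le_mul_of_pos_left k (by norm_num)).trans hk.mul_le
  calc (WeakDegeneracy.weakDegeneracy G : ℝ) ≤ (d - k : ℕ) := mod_cast hwd
    _ = d - k := Nat.cast_sub hkd
    _ ≤ d - 1 / 2 ^ 35 * √d := by linarith
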